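/- Let $0<q,r<\infty$, $1<p<\infty$ and $p'=p/(p-1)$. A weight on $(0,\infty)$ is a measurable function $(0,\infty)\to[0,\infty]$ that is positive almost everywhere; integrals are Lebesgue integrals of non-negative functions with values in $[0,\infty]$, and $0\cdot\infty=0$. Let $u,v,w$ be weights on $(0,\infty)$ such that $\int_0^x v^{1-p'}<\infty$ for all $x\in(0,\infty)$. Consider the inequality $$\left(\int_0^\infty\left(\int_x^\infty\left(\int_0^t h\right)^r u(t)\,dt\right)^{q/r}w(x)\,dx\right)^{1/q}\le C\left(\int_0^\infty h^p v\right)^{1/p}\quad\text{for all measurable } h:(0,\infty)\to[0,\infty].\qquad(*)$$ We say that $(*)$ holds if it is satisfied with some constant $C\in(0,\infty)$; its best constant is the infimum of all $C\in[0,\infty]$ for which it is satisfied ($\infty$ if $(*)$ does not hold). Put $$F_1=\sup_{x>0}\left(\int_0^x w\right)^{\frac1q}\left(\int_x^\infty u\right)^{\frac1r}\left(\int_0^x v^{1-p'}\right)^{\frac1{p'}},$$ $$F_2=\sup_{x>0}\left(\int_x^\infty\left(\int_t^\infty u\right)^{\frac qr}w(t)\,dt\right)^{\frac1q}\left(\int_0^x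 v^{1-p'}\right)^{\frac1{p'}},$$ and, if $q<p$, $$F_3=\left(\int_0^\infty\left(\sup_{t\ge x}\left(\int_t^\infty u\right)^{\frac1r}\left(\int_0^t v^{1-p'}\right)^{\frac1{p'}}\right)^{\frac{pq}{p-q}}\left(\int_0^x w\right)^{\frac q{p-q}}w(x)\,dx\right)^{\frac{p-q}{pq}},$$ $$F_4=\left(\int_0^\infty\left(\int_x^\infty\left(\int_t^\infty u\right)^{\frac qr}w(t)\,dt\right)^{\frac q{p-q}}\left(\int_x^\infty u\right)^{\frac qr}\left(\int_0^x v^{1-p'}\right)^{\frac{(p-1)q}{p-q}}w(x)\,dx\right)^{\frac{p-q}{pq}},$$ if $r<p$, $$F_5=\sup_{t>0}\left(\int_0^t w\right)^{\frac1q}\left(\int_t^\infty\left(\int_x^\infty u\right)^{\frac r{p-r}}u(x)\left(\int_0^x v^{1-p'}\right)^{\frac{(p-1)r}{p-r}}dx\right)^{\frac{p-r}{pr}},$$ and, if $\max\{q,r\}<p$, $$F_6=\left(\int_0^\infty\left(\int_0^t w\right)^{\frac q{p-q}}w(t)\left(\int_t^\infty\left(\int_x^\infty u\right)^{\frac r{p-r}}u(x)\left(\int_0^x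 v^{1-p'}\right)^{\frac{(p-1)r}{p-r}}dx\right)^{\frac{q(p-r)}{r(p-q)}}dt\right)^{\frac{p-q}{pq}}.$$ Let $C$ be the best constant in $(*)$, and write $A\approx B$ if $A\le cB$ and $B\le cA$ with a constant $c\in(0,\infty)$ depending only on $p,q,r$ (in particular not on $u,v,w$). Then: (a) If $p\le\min\{q,r\}$, then $(*)$ holds if and only if $F_1<\infty$ and $F_2<\infty$; moreover $C\approx F_1+F_2$. (b) If $q<p\le r$, then $(*)$ holds if and only if $F_3<\infty$ and $F_4<\infty$; moreover $C\approx F_3+F_4$. (c) If $r<p\le q$, then $(*)$ holds if and only if $F_2<\infty$ and $F_5<\infty$; moreover $C\approx F_2+F_5$. (d) If $\max\{q,r\}<p$, then $(*)$ holds if and only if $F_4<\infty$ and $F_6<\infty$; moreover $C\approx F_4+F_6$. -/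

import Mathlib

open MeasureTheory Set
open scoped ENNReal NNReal

namespace IteratedHardy

/-- Lebesgue measure on the half-line `(0,∞)`. -/
noncomputable abbrev halfLine : Measure ℝ := volume.restrict (Ioi 0)

/-- Non-negative (extended real valued) Lebesgue measurable functions on `(0,∞)`. Functions are
given on the whole line, but only their values on `(0,∞)` are ever used. -/
def IsMPlus (f : ℝ → ℝ≥0∞) : Prop := AEMeasurable f halfLine

/-- Weights on `(0,∞)`: measurable functions which are positive almost everywhere. -/
def IsWeight (w : ℝ → ℝ≥0∞) : Prop := IsMPlus w ∧ ∀ᵐ x ∂halfLine, 0 < w x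

/-- `∫_0^x f`. -/
noncomputable def hardy (f : ℝ → ℝ≥0∞) (x : ℝ) : ℝ≥0∞ := ∫⁻ t in Ioc 0 x, f t

/-- `∫_x^∞ f`. -/
noncomputable def copson (f : ℝ → ℝ≥0∞) (x : ℝ) : ℝ≥0∞ := ∫⁻ t in Ioi x, f t

/-- `∫_0^x v^{1-p'}`, where `p' = p / (p - 1)`. -/
noncomputable def dualPrimitive (p : ℝ) (v : ℝ → ℝ≥0∞) (x : ℝ) : ℝ≥0∞ :=
  hardy (fun t => v t ^ (1 - p.conjExponent)) x

/-- The weighted norm `(∫_0^∞ h^p v)^{1/p}`. -/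
noncomputable def wnorm (p : ℝ) (v h : ℝ → ℝ≥0∞) : ℝ≥0∞ :=
  (∫⁻ x in Ioi 0, h x ^ p * v x) ^ (1 / p)

/-- The left-hand side
`(∫_0^∞ (∫_x^∞ (∫_0^t h)^r u(t) dt)^{q/r} w(x) dx)^{1/q}` of the iterated inequality. -/
noncomputable def iterated (q r : ℝ) (u w h : ℝ → ℝ≥0∞) : ℝ≥0∞ :=
  (∫⁻ x in Ioi 0, (∫⁻ t in Ioi x, hardy h t ^ r * u t) ^ (q / r) * w x) ^ (1 / q)

/-- The iterated inequality with the constant `C`, for all `h ∈ 𝔐⁺(0,∞)`. -/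
def HoldsWith (p q r : ℝ) (u v w : ℝ → ℝ≥0∞) (C : ℝ≥0∞) : Prop :=
  ∀ h : ℝ → ℝ≥0∞, IsMPlus h → iterated q r u w h ≤ C * wnorm p v h

/-- The iterated inequality holds, with some positive finite constant. -/
def Holds (p q r : ℝ) (u v w : ℝ → ℝ≥0∞) : Prop :=
  ∃ C : ℝ≥0, 0 < C ∧ HoldsWith p q r u v w C

/-- The best constant of the iterated inequality (`∞` if the inequality does not hold). -/
noncomputable def bestConst (p q r : ℝ) (u v w : ℝ → ℝ≥0∞) : ℝ≥0∞ :=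
  sInf {C : ℝ≥0∞ | HoldsWith p q r u v w C}

noncomputable def F₁ (p q r : ℝ) (u v w : ℝ → ℝ≥0∞) : ℝ≥0∞ :=
  ⨆ x ∈ Ioi (0 : ℝ),
    hardy w x ^ (1 / q) * copson u x ^ (1 / r) * dualPrimitive p v x ^ (1 / p.conjExponent)

noncomputable def F₂ (p q r : ℝ) (u v w : ℝ → ℝ≥0∞) : ℝ≥0∞ :=
  ⨆ x ∈ Ioi (0 : ℝ),
    (∫⁻ t in Ioi x, copson u t ^ (q / r) * w t) ^ (1 / q) *
      dualPrimitive p v x ^ (1 / p.conjExponent)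

noncomputable def F₃ (p q r : ℝ) (u v w : ℝ → ℝ≥0∞) : ℝ≥0∞ :=
  (∫⁻ x in Ioi 0,
    (⨆ t ∈ Ici x, copson u t ^ (1 / r) * dualPrimitive p v t ^ (1 / p.conjExponent)) ^ (p * q / (p - q)) *
      hardy w x ^ (q / (p - q)) * w x) ^ ((p - q) / (p * q))

noncomputable def F₄ (p q r : ℝ) (u v w : ℝ → ℝ≥0∞) : ℝ≥0∞ :=
  (∫⁻ x in Ioi 0,
    (∫⁻ t in Ioi x, copson u t ^ (q / r) * w t) ^ (q / (p - q)) *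
      copson u x ^ (q / r) * dualPrimitive p v x ^ ((p - 1) * q / (p - q)) * w x)
    ^ ((p - q) / (p * q))

/-- The inner integral `∫_t^∞ (∫_x^∞ u)^{r/(p-r)} u(x) (∫_0^x v^{1-p'})^{(p-1)r/(p-r)} dx`
which occurs in `F₅` and `F₆`. -/
noncomputable def innerInt (p r : ℝ) (u v : ℝ → ℝ≥0∞) (t : ℝ) : ℝ≥0∞ :=
  ∫⁻ x in Ioi t,
    copson u x ^ (r / (p - r)) * u x * dualPrimitive p v x ^ ((p - 1) * r / (p - r))

noncomputable def F₅ (p q r : ℝ) (u v w : ℝ → ℝ≥0∞) : ℝ≥0∞ :=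
  ⨆ t ∈ Ioi (0 : ℝ), hardy w t ^ (1 / q) * innerInt p r u v t ^ ((p - r) / (p * r))

noncomputable def F₆ (p q r : ℝ) (u v w : ℝ → ℝ≥0∞) : ℝ≥0∞ :=
  (∫⁻ t in Ioi 0,
    hardy w t ^ (q / (p - q)) * w t *
      innerInt p r u v t ^ (q * (p - r) / (r * (p - q)))) ^ ((p - q) / (p * q))

/-- Two-sided estimate `a ≈ b` with the constant `c`. -/
def EquivWith (c : ℝ≥0) (a b : ℝ≥0∞) : Prop := a ≤ c * b ∧ b ≤ c * a

end IteratedHardy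

/-!
Write `σ = v ^ (1 - p')`, `V(x) = ∫_0^x σ`, `U(x) = ∫_x^∞ u`, `W(x) = ∫_0^x w` and `Hh(x) = ∫_0^x
h`. The iterated inequality is equivalent to two requirements: the Hardy inequality for `H` with
the weight `φ = U ^ (q/r) * w` in the target `L^q`, and a bound for the constants `T(x)` of the
Hardy inequalities with the weight `u` on `(x,∞)` in the target `L^r` (`IsTailConst`), weighted by
`W`: `sup W ^ (1/q) * T` if `p ≤ q`, and an integral of `T ^ (pq/(p-q))` if `q < p`. In all cases
the Hardy constants are the classical ones, a supremum (`muckenhouptConst`) if the exponent of the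
source is at most that of the target, and an integral (`mazyaConst`) otherwise. Inserting them
gives the functionals `F₁`, …, `F₆`.

Everything rests on decompositions into dyadic level sets of monotone functions, and the only
information on a measure `μ` that is needed is the relation between `μ` and its cumulative
function (`IsCumulative`), so that the integrals from the left and from the right are treated at
once.

*Sufficiency.* Level sets are taken of the monotone function that is to be integrated: `Hh` for
the Hardy inequality (`hardyNorm_le_of_blockBound`) and `x ↦ ∫_x^∞ (Hh)^r u` for the iterated
operator (`iterated_le_of_blockBound`). The value of such a function on a level set is comparable
to the mass of the next one, and this localizes `h`. For `t` in the level set that follows the one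
containing `x`, the splitting `Hh(t) = Hh(x) + ∫_x^t h` produces the two requirements. It remains
to sum over the blocks, by the embedding of `ℓ^p` into `ℓ^q` or by Hölder's inequality
(`blockBound_of_le`, `blockBound_of_lt`).

*Necessity.* For suprema, the functions `σ 1_(0,x)` suffice (`exists_extremal`). The integral
conditions for `q < p` follow from one saturation principle (`lintegral_le_opNorm`): on each
dyadic level set of the cumulative function of the outer measure, choose an almost extremal
function for the inner functional, and superpose these functions with the coefficients that
saturate Hölder's inequality. With the outer measure `φ` it gives the Hardy constant for `q < p`,
with the outer measure `w` it gives the integral of `T`.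
-/

namespace IteratedHardy

/-! ### Cumulative functions of measures -/

/-- `M` behaves like a cumulative function `x ↦ μ (Iic x)` of the measure `μ`. The three inequalities
do not mention the order, so that they hold for `x ↦ μ (Ioi x)` as well. -/
structure IsCumulative {α : Type*} [MeasurableSpace α] (μ : Measure α) (M : α → ℝ≥0∞) : Prop where
  measurable : Measurable M
  mul_measure_le : ∀ (E : Set α) (a c : ℝ≥0∞), (∀ x ∈ E, a * M x ≤ c) → a * μ E ≤ c
  le_measure_level : ∀ (y : α) (s : ℝ≥0∞), 2 * s ≤ M y → M y < ∞ →
    s ≤ μ {x | s ≤ M x ∧ M x < 2 * s}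
  rpow_measure_le : ∀ (E : Set α) (a : ℝ), MeasurableSet E → 0 ≤ a →
    μ E ^ (1 + a) ≤ 2 ^ (1 + a) * ∫⁻ x in E, M x ^ a ∂μ

section Order

variable {α : Type*} [LinearOrder α] [TopologicalSpace α] [OrderTopology α]
  [SecondCountableTopology α] [MeasurableSpace α]

/-- The measure of a set is exhausted by its initial segments. -/
theorem measure_le_of_forall_inter_Iic (μ : Measure α) (B : Set α) (c : ℝ≥0∞)
    (h : ∀ x ∈ B, μ (B ∩ Iic x) ≤ c) : μ B ≤ c := by
  by_cases hmax : ∃ x ∈ B, ∀ y ∈ B, y ≤ x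
  · obtain ⟨x, hx, hB⟩ := hmax
    have : B ∩ Iic x = B := inter_eq_left.2 hB
    rw [← this]; exact h x hx
  · push Not at hmax
    obtain ⟨T, hTB, hTc, hT⟩ := TopologicalSpace.isOpen_biUnion_countable B (fun x => Iio x)
      (fun x _ => isOpen_Iio)
    have hsub : B ⊆ ⋃ x ∈ T, B ∩ Iic x := by
      intro y hy
      obtain ⟨x, hx, hyx⟩ := hmax y hy
      have : y ∈ ⋃ i ∈ T, Iio i := by rw [hT]; exact mem_biUnion hx hyx
      simp only [mem_iUnion] at this ⊢
      obtain ⟨i, hi, hyi⟩ := this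
      exact ⟨i, hi, hy, le_of_lt hyi⟩
    refine (measure_mono hsub).trans ?_
    rw [measure_biUnion_eq_iSup hTc]
    · exact iSup₂_le fun i hi => h i (hTB hi)
    · intro a ha b hb
      rcases le_total a b with hab | hab
      · exact ⟨b, hb, inter_subset_inter_right _ (Iic_subset_Iic.2 hab), Subset.rfl⟩
      · exact ⟨a, ha, Subset.rfl, inter_subset_inter_right _ (Iic_subset_Iic.2 hab)⟩

theorem measure_le_of_forall_inter_Ioi (μ : Measure α) [NullSingletonClass μ] (B : Set α) (c : ℝ≥0∞)
    (h : ∀ x ∈ B, μ (B ∩ Ioi x) ≤ c) : μ B ≤ c := by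
  refine measure_le_of_forall_inter_Iic (α := αᵒᵈ) μ B c fun x hx => le_trans ?_ (h x hx)
  have : (B ∩ Ici (OrderDual.ofDual x) : Set α) ⊆
      (B ∩ Ioi (OrderDual.ofDual x)) ∪ {OrderDual.ofDual x} := by
    rintro y ⟨hy, hxy⟩
    rcases eq_or_lt_of_le hxy with h | h
    · exact Or.inr h.symm
    · exact Or.inl ⟨hy, h⟩
  calc μ (B ∩ Ici (OrderDual.ofDual x)) ≤ _ := measure_mono this
    _ ≤ _ := measure_union_le _ _
    _ = _ := by rw [measure_singleton, add_zero]; rfl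

/-- A substitute for `∫ F ^ a dF = F ^ (1 + a) / (1 + a)`, with the sharp constant lost. -/
theorem rpow_measure_le_of_isFiniteMeasure [BorelSpace α] (μ : Measure α) [IsFiniteMeasure μ]
    (E : Set α) (a : ℝ) (hE : MeasurableSet E) (ha : 0 ≤ a) :
    μ E ^ (1 + a) ≤ 2 ^ (1 + a) * ∫⁻ x in E, μ (Iic x) ^ a ∂μ := by
  set B : Set α := E ∩ {x | μ (E ∩ Iic x) < μ E / 2} with hB
  have hmono : Monotone fun x => μ (E ∩ Iic x) := fun x y hxy =>
    measure_mono (inter_subset_inter_right _ (Iic_subset_Iic.2 hxy))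
  have hBm : MeasurableSet B := hE.inter (hmono.measurable measurableSet_Iio)
  -- the points below which `E` has less than half of its mass carry at most half of its mass
  have hBle : μ B ≤ μ E / 2 := measure_le_of_forall_inter_Iic μ B _ fun x hx =>
    (measure_mono (inter_subset_inter_left _ inter_subset_left)).trans hx.2.le
  have hdiff : μ E / 2 ≤ μ (E \ B) := by
    rw [measure_sdiff inter_subset_left hBm.nullMeasurableSet (measure_ne_top _ _)]
    refine ENNReal.le_sub_of_add_le_left (measure_ne_top _ _) ?_
    calc μ B + μ E / 2 ≤ μ E / 2 + μ E / 2 := by gcongr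
      _ = μ E := ENNReal.add_halves _
  have hint : (μ E / 2) ^ a * μ (E \ B) ≤ ∫⁻ x in E, μ (Iic x) ^ a ∂μ := by
    calc (μ E / 2) ^ a * μ (E \ B) = ∫⁻ _ in E \ B, (μ E / 2) ^ a ∂μ := by
          rw [setLIntegral_const]
      _ ≤ ∫⁻ x in E \ B, μ (Iic x) ^ a ∂μ := by
          refine setLIntegral_mono' (hE.diff hBm) fun x hx => ?_
          refine ENNReal.rpow_le_rpow ?_ ha
          have : ¬ μ (E ∩ Iic x) < μ E / 2 := fun h => hx.2 ⟨hx.1, h⟩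
          exact (not_lt.1 this).trans (measure_mono inter_subset_right)
      _ ≤ _ := lintegral_mono_set sdiff_subset
  calc μ E ^ (1 + a) = 2 ^ (1 + a) * (μ E / 2) ^ (1 + a) := by
        rw [← ENNReal.mul_rpow_of_nonneg _ _ (by linarith),
          ENNReal.mul_div_cancel (by simp) (by simp)]
    _ = 2 ^ (1 + a) * ((μ E / 2) ^ a * (μ E / 2)) := by
        rw [add_comm 1 a, ENNReal.rpow_add_of_nonneg _ _ ha zero_le_one,
          ENNReal.rpow_add_of_nonneg _ _ ha zero_le_one, ENNReal.rpow_one, ENNReal.rpow_one]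
    _ ≤ _ := by
        gcongr
        exact (mul_le_mul_right hdiff _).trans hint

theorem isCumulative_Iic [BorelSpace α] (μ : Measure α) [SFinite μ] [NullSingletonClass μ] :
    IsCumulative μ fun x => μ (Iic x) where
  measurable := Monotone.measurable fun x y hxy => measure_mono (Iic_subset_Iic.2 hxy)
  mul_measure_le E a c h := by
    have := measure_le_of_forall_inter_Iic (a • μ) E c fun x hx => by
      rw [Measure.smul_apply, smul_eq_mul]
      exact le_trans (by gcongr; exact inter_subset_right) (h x hx)
    simpa using this
  le_measure_level y s h hy := by
    have hmono : Monotone fun x => μ (Iic x) := fun x y hxy => measure_mono (Iic_subset_Iic.2 hxy)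
    have hlow : μ {x | μ (Iic x) < s} ≤ s := measure_le_of_forall_inter_Iic μ _ _ fun x hx =>
      (measure_mono inter_subset_right).trans (le_of_lt hx)
    set t := 2 * s with ht
    have hs : s ≠ ∞ := by
      rintro rfl
      rw [ht, ENNReal.mul_top (by simp)] at h
      exact absurd hy (not_lt.2 h)
    -- the part of `Iic y` on which the cumulative function is at least `t`
    have hup : μ (Iic y ∩ {x | t ≤ μ (Iic x)}) ≤ μ (Iic y) - t := by
      refine measure_le_of_forall_inter_Ioi μ _ _ fun x hx => ?_
      have hxy : x ≤ y := hx.1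
      have hxt : t ≤ μ (Iic x) := hx.2
      have hsub : Iic y ∩ {x | t ≤ μ (Iic x)} ∩ Ioi x ⊆ Iic y \ Iic x := fun z hz =>
        ⟨hz.1.1, not_le.2 hz.2⟩
      calc _ ≤ μ (Iic y \ Iic x) := measure_mono hsub
        _ = μ (Iic y) - μ (Iic x) := measure_sdiff (Iic_subset_Iic.2 hxy)
            measurableSet_Iic.nullMeasurableSet ((hmono hxy).trans_lt hy).ne
        _ ≤ _ := tsub_le_tsub_left hxt _
    have hcover : Iic y ⊆ {x | μ (Iic x) < s} ∪ ({x | s ≤ μ (Iic x) ∧ μ (Iic x) < t} ∪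
        (Iic y ∩ {x | t ≤ μ (Iic x)})) := by
      intro x hx
      by_cases h1 : μ (Iic x) < s
      · exact Or.inl h1
      · by_cases h2 : μ (Iic x) < t
        · exact Or.inr (Or.inl ⟨not_lt.1 h1, h2⟩)
        · exact Or.inr (Or.inr ⟨hx, not_lt.1 h2⟩)
    have hsum : μ (Iic y) ≤ s + (μ {x | s ≤ μ (Iic x) ∧ μ (Iic x) < t} + (μ (Iic y) - t)) :=
      (measure_mono hcover).trans <| (measure_union_le _ _).trans <|
        add_le_add hlow <| (measure_union_le _ _).trans <| by gcongr
    have h3 : s + s + (μ (Iic y) - t) ≤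
        s + μ {x | s ≤ μ (Iic x) ∧ μ (Iic x) < t} + (μ (Iic y) - t) := by
      rw [← two_mul, ← ht, add_tsub_cancel_of_le h, add_assoc]
      exact hsum
    have h4 := (ENNReal.add_le_add_iff_right (tsub_le_self.trans_lt hy).ne).1 h3
    exact (ENNReal.add_le_add_iff_left hs).1 h4
  rpow_measure_le E a hE ha := by
    -- `μ` is the supremum of the finite measures `ν n`, with smaller cumulative functions
    have h1a : 0 < 1 + a := by linarith
    set ν : ℕ → Measure α := fun n => ∑ i ∈ Finset.range n, sfiniteSeq μ i with hν
    have hsum : ∀ s, MeasurableSet s → μ s = ∑' i, sfiniteSeq μ i s := fun s hs => by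
      conv_lhs => rw [← sum_sfiniteSeq μ]
      exact Measure.sum_apply _ hs
    have hνle : ∀ n, ν n ≤ μ := fun n => Measure.le_iff.2 fun s hs => by
      rw [hsum s hs, hν, Measure.finsetSum_apply]
      exact ENNReal.sum_le_tsum _
    have hn : ∀ n, ν n E ≤ (2 ^ (1 + a) * ∫⁻ x in E, μ (Iic x) ^ a ∂μ) ^ (1 + a)⁻¹ := fun n => by
      rw [ENNReal.le_rpow_inv_iff h1a]
      refine (rpow_measure_le_of_isFiniteMeasure (ν n) E a hE ha).trans ?_
      gcongr <;> exact hνle n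
    rw [← ENNReal.le_rpow_inv_iff h1a, hsum E hE, ENNReal.tsum_eq_iSup_nat]
    refine iSup_le fun n => ?_
    have := hn n
    rwa [hν, Measure.finsetSum_apply] at this

theorem isCumulative_Ioi [BorelSpace α] (μ : Measure α) [h1 : SFinite μ]
    [h2 : NullSingletonClass μ] :
    IsCumulative μ fun x => μ (Ioi x) := by
  have e : (fun x => μ (Ioi x)) = fun x => μ (Ici x) := funext fun x =>
    measure_congr Ioi_ae_eq_Ici
  rw [e]
  -- for the reversed order `Ici` is `Iic`; the fields of `IsCumulative` do not depend on the order
  have := @isCumulative_Iic αᵒᵈ _ _ _ _ _ _ μ h1 h2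
  exact ⟨this.1, this.2, this.3, this.4⟩

end Order

/-! ### Dyadic level sets -/

/-- The set where `2 ^ k ≤ M < 2 ^ (k + 1)`. -/
def dyadicBlock {α : Type*} (M : α → ℝ≥0∞) (k : ℤ) : Set α := {x | 2 ^ k ≤ M x ∧ M x < 2 * 2 ^ k}

theorem two_zpow_succ (k : ℤ) : (2 : ℝ≥0∞) ^ (k + 1) = 2 * 2 ^ k := by
  rw [ENNReal.zpow_add (by simp) (by simp), zpow_one, mul_comm]

theorem two_mul_two_zpow_pred (k : ℤ) : 2 * (2 : ℝ≥0∞) ^ (k - 1) = 2 ^ k := by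
  rw [← two_zpow_succ, sub_add_cancel]

section Blocks

variable {α : Type*} {M : α → ℝ≥0∞}

theorem measurableSet_dyadicBlock [MeasurableSpace α] (hM : Measurable M) (k : ℤ) :
    MeasurableSet (dyadicBlock M k) :=
  (hM measurableSet_Ici).inter (hM measurableSet_Iio)

theorem lt_of_mem_dyadicBlock {j k : ℤ} (hjk : j < k) {x y : α} (hx : x ∈ dyadicBlock M j)
    (hy : y ∈ dyadicBlock M k) : M x < M y := by
  refine hx.2.trans_le (le_trans ?_ hy.1)
  rw [← two_zpow_succ]
  exact ENNReal.zpow_le_of_le (by norm_num) hjk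

theorem pairwise_disjoint_dyadicBlock (M : α → ℝ≥0∞) :
    Pairwise (Function.onFun Disjoint (dyadicBlock M)) := by
  intro j k hjk
  refine Set.disjoint_left.2 fun x hx hx' => ?_
  rcases lt_or_gt_of_ne hjk with h | h
  · exact lt_irrefl _ (lt_of_mem_dyadicBlock h hx hx')
  · exact lt_irrefl _ (lt_of_mem_dyadicBlock h hx' hx)

theorem exists_mem_dyadicBlock {x : α} (h0 : M x ≠ 0) (h1 : M x ≠ ∞) : ∃ k, x ∈ dyadicBlock M k := by
  obtain ⟨k, hk, hk'⟩ := ENNReal.exists_mem_Ico_zpow h0 h1 (y := 2) (by norm_num) (by simp)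
  exact ⟨k, hk, by rwa [← two_zpow_succ]⟩

theorem lintegral_le_tsum_dyadicBlock [MeasurableSpace α] {μ : Measure α} (hM : Measurable M)
    {f : α → ℝ≥0∞} (hf : ∀ᵐ x ∂μ, (M x = 0 ∨ M x = ∞) → f x = 0) :
    ∫⁻ x, f x ∂μ ≤ ∑' k, ∫⁻ x in dyadicBlock M k, f x ∂μ := by
  have hU : MeasurableSet (⋃ k, dyadicBlock M k) :=
    MeasurableSet.iUnion fun k => measurableSet_dyadicBlock hM k
  rw [← lintegral_iUnion (measurableSet_dyadicBlock hM) (pairwise_disjoint_dyadicBlock M),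
    ← lintegral_indicator hU]
  refine lintegral_mono_ae ?_
  filter_upwards [hf] with x hx
  by_cases h : M x = 0 ∨ M x = ∞
  · simp [hx h]
  · push Not at h
    rw [indicator_of_mem (mem_iUnion.2 (exists_mem_dyadicBlock h.1 h.2))]

theorem tsum_lintegral_dyadicBlock_le [MeasurableSpace α] {μ : Measure α} (hM : Measurable M)
    (f : α → ℝ≥0∞) : ∑' k, ∫⁻ x in dyadicBlock M k, f x ∂μ ≤ ∫⁻ x, f x ∂μ := by
  rw [← lintegral_iUnion (measurableSet_dyadicBlock hM) (pairwise_disjoint_dyadicBlock M)]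
  exact setLIntegral_le_lintegral _ _

end Blocks

/-! ### Sums over blocks -/

theorem tsum_rpow_le_rpow_tsum {ι : Type*} (g : ι → ℝ≥0∞) {s : ℝ} (hs : 1 ≤ s) :
    ∑' k, g k ^ s ≤ (∑' k, g k) ^ s := by
  have hsplit : ∀ a : ℝ≥0∞, a ^ s = a * a ^ (s - 1) := fun a => by
    conv_lhs => rw [show s = 1 + (s - 1) by ring,
      ENNReal.rpow_add_of_nonneg _ _ zero_le_one (by linarith), ENNReal.rpow_one]
  calc ∑' k, g k ^ s ≤ ∑' k, g k * (∑' k, g k) ^ (s - 1) := by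
        refine ENNReal.tsum_le_tsum fun k => ?_
        rw [hsplit]
        gcongr _ * ?_
        exact ENNReal.rpow_le_rpow (ENNReal.le_tsum k) (by linarith)
    _ = _ := by rw [ENNReal.tsum_mul_right, ← hsplit]

theorem tsum_rpow_mul_rpow_le {ι : Type*} (f g : ι → ℝ≥0∞) {a b : ℝ} (ha : 0 ≤ a) (hb : 0 ≤ b)
    (hab : a + b = 1) : ∑' k, f k ^ a * g k ^ b ≤ (∑' k, f k) ^ a * (∑' k, g k) ^ b := by
  let : MeasurableSpace ι := ⊤
  have : MeasurableSingletonClass ι := ⟨fun _ => trivial⟩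
  have := ENNReal.lintegral_mul_norm_pow_le (μ := Measure.count) (f := f) (g := g)
    (measurable_from_top).aemeasurable (measurable_from_top).aemeasurable ha hb hab
  simpa only [lintegral_count] using this

/-- `D` bounds the embedding of a block sequence: if on each block `E k` the number `n k` is at most
`J` times the `1/p`-th power of `g k`, then the `q`-sum of `n` weighted by the masses of the
blocks is controlled by the sum of `g`. -/
def BlockBound (p q : ℝ) (μ : Measure ℝ) (J : ℝ → ℝ≥0∞) (D : ℝ≥0∞) : Prop :=
  ∀ (E : ℤ → Set ℝ) (n g : ℤ → ℝ≥0∞), (∀ k, MeasurableSet (E k)) → (∀ k, E k ⊆ Ioi 0) →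
    Pairwise (Function.onFun Disjoint E) → (∀ k, ∀ x ∈ E k, n k ≤ J x * g k ^ (1 / p)) →
    ∑' k, n k ^ q * μ (E k) ≤ D ^ q * (∑' k, g k) ^ (q / p)

theorem blockBound_of_le {μ : Measure ℝ} {M : ℝ → ℝ≥0∞} (hM : IsCumulative μ M) {p q : ℝ}
    (hp : 0 < p) (hpq : p ≤ q) {J : ℝ → ℝ≥0∞} {D : ℝ≥0∞}
    (hD : ∀ x, 0 < x → M x ^ (1 / q) * J x ≤ D) : BlockBound p q μ J D := by
  intro E n g _ hE _ hn
  have hq : 0 < q := hp.trans_le hpq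
  calc ∑' k, n k ^ q * μ (E k) ≤ ∑' k, D ^ q * g k ^ (q / p) := by
        refine ENNReal.tsum_le_tsum fun k => hM.mul_measure_le _ _ _ fun x hx => ?_
        calc n k ^ q * M x ≤ (J x * g k ^ (1 / p)) ^ q * (M x ^ (1 / q)) ^ q := by
              gcongr
              · exact hn k x hx
              · rw [← ENNReal.rpow_mul, one_div_mul_cancel hq.ne', ENNReal.rpow_one]
          _ = (M x ^ (1 / q) * J x) ^ q * g k ^ (q / p) := by
              rw [ENNReal.mul_rpow_of_nonneg _ _ hq.le, ENNReal.mul_rpow_of_nonneg _ _ hq.le,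
                ← ENNReal.rpow_mul (g k), one_div_mul_eq_div]
              ring
          _ ≤ _ := by gcongr; exact hD x (hE k hx)
    _ = D ^ q * ∑' k, g k ^ (q / p) := ENNReal.tsum_mul_left
    _ ≤ _ := by
        gcongr
        exact tsum_rpow_le_rpow_tsum g ((one_le_div hp).2 hpq)

theorem blockBound_of_lt {μ : Measure ℝ} {M : ℝ → ℝ≥0∞} (hM : IsCumulative μ M) {p q : ℝ}
    (hq : 0 < q) (hqp : q < p) {J : ℝ → ℝ≥0∞} (hJ : Measurable J) :
    BlockBound p q μ J (2 ^ (1 / q) *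
      (∫⁻ x, J x ^ (p * q / (p - q)) * M x ^ (q / (p - q)) ∂μ) ^ ((p - q) / (p * q))) := by
  intro E n g hEm _ hdisj hn
  have hp : 0 < p := hq.trans hqp
  have hd : 0 < p - q := sub_pos.2 hqp
  set Q : ℤ → ℝ≥0∞ := fun k => ∫⁻ x in E k, J x ^ (p * q / (p - q)) * M x ^ (q / (p - q)) ∂μ with hQ
  have hblock : ∀ k, n k ^ q * μ (E k) ≤ 2 * (g k ^ (q / p) * Q k ^ ((p - q) / p)) := fun k => by
    have h1 : n k ^ (p * q / (p - q)) * μ (E k) ^ (1 + q / (p - q)) ≤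
        2 ^ (1 + q / (p - q)) * (g k ^ (q / (p - q)) * Q k) := by
      calc _ ≤ n k ^ (p * q / (p - q)) * (2 ^ (1 + q / (p - q)) *
            ∫⁻ x in E k, M x ^ (q / (p - q)) ∂μ) := by
            gcongr
            exact hM.rpow_measure_le _ _ (hEm k) (by positivity)
        _ = 2 ^ (1 + q / (p - q)) *
            ∫⁻ x in E k, n k ^ (p * q / (p - q)) * M x ^ (q / (p - q)) ∂μ := by
            rw [lintegral_const_mul _ (hM.measurable.pow_const _)]; ring
        _ ≤ 2 ^ (1 + q / (p - q)) *
            ∫⁻ x in E k, g k ^ (q / (p - q)) *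
              (J x ^ (p * q / (p - q)) * M x ^ (q / (p - q))) ∂μ := by
            gcongr 2 ^ (1 + q / (p - q)) * ?_
            refine setLIntegral_mono' (hEm k) fun x hx => ?_
            rw [← mul_assoc]
            gcongr
            calc n k ^ (p * q / (p - q)) ≤ (J x * g k ^ (1 / p)) ^ (p * q / (p - q)) := by
                  gcongr
                  exact hn k x hx
              _ = _ := by
                  rw [ENNReal.mul_rpow_of_nonneg _ _ (by positivity), ← ENNReal.rpow_mul, mul_comm]
                  congr 2
                  field_simp
        _ ≤ _ := by
            exact mul_le_mul_right (lintegral_const_mul _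
              (Measurable.mul (hJ.pow_const _) (hM.measurable.pow_const _))).le _
    have h2 := ENNReal.rpow_le_rpow h1 (show 0 ≤ (p - q) / p by positivity)
    have e1 : (1 + q / (p - q)) * ((p - q) / p) = 1 := by field_simp; ring
    have e2 : p * q / (p - q) * ((p - q) / p) = q := by field_simp
    have e3 : q / (p - q) * ((p - q) / p) = q / p := by field_simp
    rw [ENNReal.mul_rpow_of_nonneg _ _ (by positivity), ENNReal.mul_rpow_of_nonneg _ _ (by positivity),
      ENNReal.mul_rpow_of_nonneg _ _ (by positivity), ← ENNReal.rpow_mul, ← ENNReal.rpow_mul,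
      ← ENNReal.rpow_mul, ← ENNReal.rpow_mul, e1, e2, e3, ENNReal.rpow_one, ENNReal.rpow_one] at h2
    exact h2
  calc ∑' k, n k ^ q * μ (E k) ≤ ∑' k, 2 * (g k ^ (q / p) * Q k ^ ((p - q) / p)) :=
        ENNReal.tsum_le_tsum hblock
    _ = 2 * ∑' k, g k ^ (q / p) * Q k ^ ((p - q) / p) := ENNReal.tsum_mul_left
    _ ≤ 2 * ((∑' k, g k) ^ (q / p) * (∑' k, Q k) ^ ((p - q) / p)) := by
        gcongr
        exact tsum_rpow_mul_rpow_le _ _ (by positivity) (by positivity) (by field_simp; ring)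
    _ ≤ 2 * ((∑' k, g k) ^ (q / p) *
          (∫⁻ x, J x ^ (p * q / (p - q)) * M x ^ (q / (p - q)) ∂μ) ^ ((p - q) / p)) := by
        gcongr
        rw [hQ, ← lintegral_iUnion hEm hdisj]
        exact setLIntegral_le_lintegral _ _
    _ = _ := by
        rw [ENNReal.mul_rpow_of_nonneg _ _ hq.le, ← ENNReal.rpow_mul, ← ENNReal.rpow_mul,
          one_div_mul_cancel hq.ne', ENNReal.rpow_one,
          show (p - q) / (p * q) * q = (p - q) / p by field_simp]
        ring

/-! ### Norms of positive functionals on the weighted Lebesgue space -/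

/-- The norm of a positively homogeneous functional `Λ` on the cone of the non-negative functions of
the weighted space with norm `wnorm p v`. -/
noncomputable def opNorm (p : ℝ) (v : ℝ → ℝ≥0∞) (Λ : (ℝ → ℝ≥0∞) → ℝ≥0∞) : ℝ≥0∞ :=
  ⨆ (h : ℝ → ℝ≥0∞) (_ : IsMPlus h ∧ wnorm p v h ≤ 1), Λ h

theorem le_opNorm {p : ℝ} {v : ℝ → ℝ≥0∞} {Λ : (ℝ → ℝ≥0∞) → ℝ≥0∞} {h : ℝ → ℝ≥0∞} (hh : IsMPlus h)
    (h1 : wnorm p v h ≤ 1) : Λ h ≤ opNorm p v Λ :=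
  le_iSup₂_of_le h ⟨hh, h1⟩ le_rfl

theorem wnorm_rpow {p : ℝ} (hp : 0 < p) (v h : ℝ → ℝ≥0∞) :
    wnorm p v h ^ p = ∫⁻ x in Ioi 0, h x ^ p * v x := by
  rw [wnorm, ← ENNReal.rpow_mul, one_div_mul_cancel hp.ne', ENNReal.rpow_one]

theorem wnorm_const_mul {p : ℝ} (hp : 0 < p) (v h : ℝ → ℝ≥0∞) {c : ℝ≥0∞} (hc : c ≠ ∞) :
    wnorm p v (fun t => c * h t) = c * wnorm p v h := by
  have : ∀ x, (c * h x) ^ p * v x = c ^ p * (h x ^ p * v x) := fun x => by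
    rw [ENNReal.mul_rpow_of_nonneg _ _ hp.le, mul_assoc]
  simp only [wnorm, this]
  rw [lintegral_const_mul' _ _ (by simp [hc, hp.le]),
    ENNReal.mul_rpow_of_nonneg _ _ (by positivity), ← ENNReal.rpow_mul, mul_one_div_cancel hp.ne',
    ENNReal.rpow_one]

theorem le_opNorm_mul {p : ℝ} (hp : 0 < p) {v : ℝ → ℝ≥0∞} {Λ : (ℝ → ℝ≥0∞) → ℝ≥0∞}
    (hΛ : ∀ (c : ℝ≥0∞) h, c ≠ ∞ → Λ (fun t => c * h t) = c * Λ h) (hfin : opNorm p v Λ ≠ ∞)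
    {h : ℝ → ℝ≥0∞} (hh : IsMPlus h) (h1 : wnorm p v h ≠ ∞) :
    Λ h ≤ opNorm p v Λ * wnorm p v h := by
  by_cases h0 : wnorm p v h = 0
  · rw [h0, mul_zero, nonpos_iff_eq_zero]
    by_contra hne
    refine hfin (ENNReal.eq_top_of_forall_nnreal_le fun c => ?_)
    -- all multiples of `h` have norm `0`, and `Λ` is unbounded on them
    by_cases htop : Λ h = ∞
    · exact le_trans (by simp [htop]) (le_opNorm hh (by simp [h0]))
    have hc : (c : ℝ≥0∞) / Λ h ≠ ∞ := ENNReal.div_ne_top (by simp) hne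
    have := le_opNorm (Λ := Λ) (p := p) (v := v) (h := fun t => c / Λ h * h t) (hh.const_mul _)
      (by rw [wnorm_const_mul hp _ _ hc, h0]; simp)
    rwa [hΛ _ _ hc, ENNReal.div_mul_cancel hne htop] at this
  · have hc : (wnorm p v h)⁻¹ ≠ ∞ := by simp [h0]
    have := le_opNorm (Λ := Λ) (p := p) (v := v) (h := fun t => (wnorm p v h)⁻¹ * h t)
      (hh.const_mul _) (by rw [wnorm_const_mul hp _ _ hc, ENNReal.inv_mul_cancel h0 h1])
    rw [hΛ _ _ hc] at this
    calc Λ h = (wnorm p v h)⁻¹ * Λ h * wnorm p v h := by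
          rw [mul_right_comm, ENNReal.inv_mul_cancel h0 h1, one_mul]
      _ ≤ _ := by gcongr

/-! ### Necessity: saturation of monotone families of functionals -/

/-- If `Λ h` is the `L^q(μ)`-norm of `x ↦ A x h`, where `A` decreases when the cumulative function
`M` of `μ` increases, then for `q < p` the norm of `Λ` dominates a weighted norm of the function
`x ↦ opNorm (A x)`. On each dyadic block of `M` a nearly extremal function is chosen, and these
functions are superposed with the coefficients that saturate Hölder's inequality. -/
theorem lintegral_le_opNorm {p q : ℝ} (hq : 0 < q) (hqp : q < p) {μ : Measure ℝ}
    {M : ℝ → ℝ≥0∞} (hM : IsCumulative μ M) {v : ℝ → ℝ≥0∞} (hv : IsMPlus v)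
    (A : ℝ → (ℝ → ℝ≥0∞) → ℝ≥0∞) (hmono : ∀ x, Monotone (A x))
    (hsmul : ∀ x (c : ℝ≥0∞) h, c ≠ ∞ → A x (fun t => c * h t) = c * A x h)
    (hord : ∀ x y, M x < M y → ∀ h, A y h ≤ A x h)
    (hMA : ∀ y h, M y ^ (1 / q) * A y h ≤ (∫⁻ x, A x h ^ q ∂μ) ^ (1 / q))
    (J : ℝ → ℝ≥0∞) (hJ : ∀ x, J x ≤ opNorm p v (A x)) :
    (∫⁻ x, J x ^ (p * q / (p - q)) * M x ^ (q / (p - q)) ∂μ) ^ ((p - q) / (p * q)) ≤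
      (2 ^ q * 4) ^ (1 / q) * opNorm p v (fun h => (∫⁻ x, A x h ^ q ∂μ) ^ (1 / q)) := by
  have hp : 0 < p := hq.trans hqp
  have hd : 0 < p - q := sub_pos.2 hqp
  have hqd : 0 < q / (p - q) := by positivity
  have hpd : 0 < p / (p - q) := by positivity
  have hpqd : 0 < p * q / (p - q) := by positivity
  set Λ : (ℝ → ℝ≥0∞) → ℝ≥0∞ := fun h => (∫⁻ x, A x h ^ q ∂μ) ^ (1 / q) with hΛ
  set C := opNorm p v Λ with hC
  have hCpos : (2 ^ q * 4 : ℝ≥0∞) ≠ 0 := by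
    simp [hq.not_gt]
  by_cases hCtop : C = ∞
  · rw [hCtop, ENNReal.mul_top]
    · exact le_top
    · simp [hCpos, hq.not_gt]
  have hΛsmul : ∀ (c : ℝ≥0∞) h, c ≠ ∞ → Λ (fun t => c * h t) = c * Λ h := fun c h hc => by
    simp only [hΛ, hsmul _ c h hc, ENNReal.mul_rpow_of_nonneg _ _ hq.le]
    rw [lintegral_const_mul' _ _ (by simp [hc, hq.le]), ENNReal.mul_rpow_of_nonneg _ _ (by positivity),
      ← ENNReal.rpow_mul, mul_one_div_cancel hq.ne', ENNReal.rpow_one]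
  -- in particular `J` vanishes where `M` is infinite, and `J` is finite where `M` is positive
  have hMJ : ∀ y, M y ^ (1 / q) * J y ≤ C := fun y => by
    calc M y ^ (1 / q) * J y ≤ M y ^ (1 / q) * opNorm p v (A y) := by gcongr; exact hJ y
      _ ≤ C := by
        simp only [opNorm, ENNReal.mul_iSup]
        exact iSup₂_le fun h hh => (hMA y h).trans (le_opNorm hh.1 hh.2)
  set s : ℤ → ℝ≥0∞ := fun k => ⨆ x ∈ dyadicBlock M k, J x with hs
  have hsfin : ∀ k, s k ≠ ∞ := fun k hk => by
    have h0 : ((2 : ℝ≥0∞) ^ k) ^ (1 / q) ≠ 0 :=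
      (ENNReal.rpow_pos (ENNReal.zpow_pos (by simp) (by simp) k)
        (ENNReal.zpow_ne_top (by simp) (by simp) k)).ne'
    have : ((2 : ℝ≥0∞) ^ k) ^ (1 / q) * s k ≤ C := by
      simp only [hs, ENNReal.mul_iSup]
      exact iSup₂_le fun x hx => le_trans (by gcongr; exact hx.1) (hMJ x)
    rw [hk, ENNReal.mul_top h0] at this
    exact hCtop (top_le_iff.1 this)
  have hext : ∀ k, ∃ h, IsMPlus h ∧ wnorm p v h ≤ 1 ∧
      (s k / 2) ^ q * 2 ^ (k - 1) ≤ ∫⁻ _ in dyadicBlock M (k - 1), (s k / 2) ^ q ∂μ ∧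
      ∀ x ∈ dyadicBlock M (k - 1), s k / 2 ≤ A x h := fun k => by
    by_cases h0 : s k = 0
    · refine ⟨fun _ => 0, aemeasurable_const, ?_, ?_⟩
      · simp [wnorm, hp]
      · simp [h0, hq]
    · obtain ⟨y, hy, hsy⟩ : ∃ y ∈ dyadicBlock M k, s k / 2 < J y := by
        have := ENNReal.half_lt_self h0 (hsfin k)
        rw [hs] at this
        simpa only [lt_iSup_iff, exists_prop] using this
      obtain ⟨h, hh, hsh⟩ : ∃ h, (IsMPlus h ∧ wnorm p v h ≤ 1) ∧ s k / 2 < A y h := by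
        have := hsy.trans_le (hJ y)
        rw [opNorm] at this
        simpa only [lt_iSup_iff, exists_prop] using this
      refine ⟨h, hh.1, hh.2, ?_, fun x hx => hsh.le.trans (hord x y
        (lt_of_mem_dyadicBlock (by linarith) hx hy) h)⟩
      rw [setLIntegral_const]
      gcongr
      refine hM.le_measure_level y _ ?_ ?_
      · rw [two_mul_two_zpow_pred]; exact hy.1
      · exact hy.2.trans_le le_top
  choose f hfm hf1 hfmass hfA using hext
  -- `β k ^ (1 / q)` bounds from below what `f k` contributes to `Λ` on the block `k - 1`; the coefficients
  -- `θ k` below give equality in Hölder's inequality for `∑ θ k ^ q * β k`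
  set β : ℤ → ℝ≥0∞ := fun k => (s k / 2) ^ q * 2 ^ (k - 1) with hβ
  have hβfin : ∀ k, β k ≠ ∞ := fun k => ENNReal.mul_ne_top
    (ENNReal.rpow_ne_top_of_nonneg hq.le (ENNReal.div_ne_top (hsfin k) (by simp)))
    (ENNReal.zpow_ne_top (by simp) (by simp) _)
  have hsumβ : ∑' k, β k ^ (p / (p - q)) ≤ C ^ (p * q / (p - q)) := by
    rw [ENNReal.tsum_eq_iSup_sum]
    refine iSup_le fun F => ?_
    set B := ∑ k ∈ F, β k ^ (p / (p - q)) with hB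
    set θ : ℤ → ℝ≥0∞ := fun k => β k ^ (1 / (p - q)) with hθ
    have hθfin : ∀ k, θ k ≠ ∞ := fun k =>
      ENNReal.rpow_ne_top_of_nonneg (by positivity) (hβfin k)
    have hBfin : B ≠ ∞ := ENNReal.sum_ne_top.2 fun k _ =>
      ENNReal.rpow_ne_top_of_nonneg (by positivity) (hβfin k)
    -- an `ℓ^p`-superposition, so that the `p`-th powers of the norms add up
    set g : ℝ → ℝ≥0∞ := fun t => (∑ k ∈ F, (θ k * f k t) ^ p) ^ (1 / p) with hg
    have hgm : IsMPlus g := by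
      refine AEMeasurable.pow_const (Finset.aemeasurable_fun_sum _ fun k _ => ?_) _
      exact ((hfm k).const_mul _).pow_const _
    have hgp : ∀ t, g t ^ p = ∑ k ∈ F, (θ k * f k t) ^ p := fun t => by
      simp only [hg]
      rw [← ENNReal.rpow_mul, one_div_mul_cancel hp.ne', ENNReal.rpow_one]
    have hgnorm : wnorm p v g ^ p ≤ B := by
      rw [wnorm_rpow hp]
      simp only [hgp, Finset.sum_mul]
      have hmeas : ∀ k ∈ F, AEMeasurable (fun x => (θ k * f k x) ^ p * v x) halfLine := fun k _ =>
        (((hfm k).const_mul _).pow_const _).mul hv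
      rw [lintegral_finsetSum' _ hmeas]
      refine Finset.sum_le_sum fun k _ => ?_
      calc _ = wnorm p v (fun t => θ k * f k t) ^ p := (wnorm_rpow hp _ _).symm
        _ = (θ k * wnorm p v (f k)) ^ p := by rw [wnorm_const_mul hp _ _ (hθfin k)]
        _ ≤ (θ k * 1) ^ p := by gcongr; exact hf1 k
        _ = _ := by
            rw [mul_one, hθ, ← ENNReal.rpow_mul]
            congr 1
            field_simp
    have hgle : ∀ k ∈ F, ∀ t, θ k * f k t ≤ g t := fun k hk t => by
      rw [← ENNReal.rpow_le_rpow_iff hp, hgp]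
      exact Finset.single_le_sum (f := fun k => (θ k * f k t) ^ p) (fun _ _ => zero_le) hk
    have hgtop : wnorm p v g ≠ ∞ := fun h => by
      rw [h, ENNReal.top_rpow_of_pos hp] at hgnorm
      exact hBfin (top_le_iff.1 hgnorm)
    have hlow : B ≤ ∫⁻ x, A x g ^ q ∂μ := by
      calc B ≤ ∑ k ∈ F, ∫⁻ x in dyadicBlock M (k - 1), A x g ^ q ∂μ := by
            refine Finset.sum_le_sum fun k hk => ?_
            calc β k ^ (p / (p - q)) = θ k ^ q * β k := by
                  rw [hθ]
                  simp only
                  rw [← ENNReal.rpow_mul, show p / (p - q) = 1 / (p - q) * q + 1 by field_simp; ring,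
                    ENNReal.rpow_add_of_nonneg _ _ (by positivity) zero_le_one, ENNReal.rpow_one]
              _ ≤ θ k ^ q * ∫⁻ _ in dyadicBlock M (k - 1), (s k / 2) ^ q ∂μ := by
                  gcongr
                  exact hfmass k
              _ = ∫⁻ _ in dyadicBlock M (k - 1), (θ k * (s k / 2)) ^ q ∂μ := by
                  rw [setLIntegral_const, setLIntegral_const, ENNReal.mul_rpow_of_nonneg _ _ hq.le,
                    mul_assoc]
              _ ≤ _ := by
                  refine setLIntegral_mono' (measurableSet_dyadicBlock hM.measurable _) fun x hx => ?_
                  gcongr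
                  calc θ k * (s k / 2) ≤ θ k * A x (f k) := by gcongr; exact hfA k x hx
                    _ = A x (fun t => θ k * f k t) := (hsmul x _ _ (hθfin k)).symm
                    _ ≤ A x g := hmono x (hgle k hk)
        _ = ∑ k ∈ F.map (Equiv.subRight (1 : ℤ)).toEmbedding,
              ∫⁻ x in dyadicBlock M k, A x g ^ q ∂μ := by simp
        _ ≤ ∑' k, ∫⁻ x in dyadicBlock M k, A x g ^ q ∂μ := ENNReal.sum_le_tsum _
        _ ≤ _ := tsum_lintegral_dyadicBlock_le hM.measurable _
    have hup : B ≤ C ^ q * B ^ (q / p) := by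
      calc B ≤ Λ g ^ q := by
            rw [hΛ]
            simp only
            rwa [← ENNReal.rpow_mul, one_div_mul_cancel hq.ne', ENNReal.rpow_one]
        _ ≤ (C * wnorm p v g) ^ q := by
            gcongr
            exact le_opNorm_mul hp hΛsmul hCtop hgm hgtop
        _ ≤ _ := by
            rw [ENNReal.mul_rpow_of_nonneg _ _ hq.le]
            gcongr
            rw [show q = p * (q / p) by field_simp, ENNReal.rpow_mul]
            rw [show p * (q / p) / p = q / p by field_simp]
            gcongr
    by_cases hB0 : B = 0
    · rw [hB0]; exact zero_le
    have h3 : B ^ ((p - q) / p) ≤ C ^ q := by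
      have e : B = B ^ ((p - q) / p) * B ^ (q / p) := by
        rw [← ENNReal.rpow_add _ _ hB0 hBfin, show (p - q) / p + q / p = 1 by field_simp; ring,
          ENNReal.rpow_one]
      have hne : B ^ (q / p) ≠ 0 := (ENNReal.rpow_pos (pos_iff_ne_zero.2 hB0) hBfin).ne'
      have hnt : B ^ (q / p) ≠ ∞ := ENNReal.rpow_ne_top_of_nonneg (by positivity) hBfin
      rw [← ENNReal.mul_le_mul_iff_left hne hnt, ← e]
      exact hup
    calc B = (B ^ ((p - q) / p)) ^ (p / (p - q)) := by
          rw [← ENNReal.rpow_mul, show (p - q) / p * (p / (p - q)) = 1 by field_simp,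
            ENNReal.rpow_one]
      _ ≤ (C ^ q) ^ (p / (p - q)) := by gcongr
      _ = _ := by
          rw [← ENNReal.rpow_mul]; congr 1; ring
  have hmain : ∫⁻ x, J x ^ (p * q / (p - q)) * M x ^ (q / (p - q)) ∂μ ≤
      ((2 ^ q * 4) ^ (1 / q) * C) ^ (p * q / (p - q)) := by
    calc _ ≤ ∑' k, ∫⁻ x in dyadicBlock M k, J x ^ (p * q / (p - q)) * M x ^ (q / (p - q)) ∂μ := by
          refine lintegral_le_tsum_dyadicBlock hM.measurable
            (Filter.Eventually.of_forall fun x hx => ?_)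
          rcases hx with hx | hx
          · rw [hx, ENNReal.zero_rpow_of_pos hqd, mul_zero]
          · have := hMJ x
            rw [hx, ENNReal.top_rpow_of_pos (by positivity)] at this
            have hJ0 : J x = 0 := by
              by_contra hne
              rw [ENNReal.top_mul hne] at this
              exact hCtop (top_le_iff.1 this)
            rw [hJ0, ENNReal.zero_rpow_of_pos hpqd, zero_mul]
      _ ≤ ∑' k, (2 ^ q * 4) ^ (p / (p - q)) * β k ^ (p / (p - q)) := by
          refine ENNReal.tsum_le_tsum fun k => ?_
          have hmass : μ (dyadicBlock M k) ≤ 2 * 2 ^ k := by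
            have := hM.mul_measure_le (dyadicBlock M k) 1 (2 * 2 ^ k) fun x hx => by
              rw [one_mul]; exact hx.2.le
            rwa [one_mul] at this
          calc _ ≤ ∫⁻ _ in dyadicBlock M k,
                s k ^ (p * q / (p - q)) * (2 * 2 ^ k) ^ (q / (p - q)) ∂μ := by
                refine setLIntegral_mono' (measurableSet_dyadicBlock hM.measurable _) fun x hx => ?_
                gcongr
                · exact le_iSup₂_of_le x hx le_rfl
                · exact hx.2.le
            _ ≤ s k ^ (p * q / (p - q)) * (2 * 2 ^ k) ^ (q / (p - q)) * (2 * 2 ^ k) := by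
                rw [setLIntegral_const]
                gcongr
            _ = (s k ^ q) ^ (p / (p - q)) * (2 * 2 ^ k) ^ (p / (p - q)) := by
                rw [← ENNReal.rpow_mul, show p / (p - q) = q / (p - q) + 1 by field_simp; ring,
                  ENNReal.rpow_add_of_nonneg _ _ hqd.le zero_le_one, ENNReal.rpow_one, mul_assoc,
                  show q * (q / (p - q) + 1) = p * q / (p - q) by field_simp; ring]
            _ = _ := by
                rw [← ENNReal.mul_rpow_of_nonneg _ _ hpd.le, ← ENNReal.mul_rpow_of_nonneg _ _ hpd.le,
                  hβ, ← two_mul_two_zpow_pred k]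
                simp only
                congr 1
                rw [show s k ^ q = 2 ^ q * (s k / 2) ^ q by
                  rw [← ENNReal.mul_rpow_of_nonneg _ _ hq.le,
                    ENNReal.mul_div_cancel (by simp) (by simp)]]
                ring
      _ ≤ (2 ^ q * 4) ^ (p / (p - q)) * C ^ (p * q / (p - q)) := by
          rw [ENNReal.tsum_mul_left]
          gcongr
      _ = _ := by
          rw [ENNReal.mul_rpow_of_nonneg _ _ hpqd.le, ← ENNReal.rpow_mul]
          congr 2
          field_simp
  calc _ ≤ (((2 ^ q * 4) ^ (1 / q) * C) ^ (p * q / (p - q))) ^ ((p - q) / (p * q)) := by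
        gcongr
    _ = _ := by
        rw [← ENNReal.rpow_mul, show p * q / (p - q) * ((p - q) / (p * q)) = 1 by field_simp,
          ENNReal.rpow_one]

/-! ### Measures with a density on the half-line -/

/-- The measure on `(0,∞)` with density `f`. -/
noncomputable def densityMeasure (f : ℝ → ℝ≥0∞) : Measure ℝ := halfLine.withDensity f

instance (f : ℝ → ℝ≥0∞) : SFinite (densityMeasure f) :=
  inferInstanceAs (SFinite (halfLine.withDensity f))

instance (f : ℝ → ℝ≥0∞) : NullSingletonClass (densityMeasure f) where
  measure_singleton x := withDensity_absolutelyContinuous halfLine f (measure_singleton x)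

theorem densityMeasure_apply (f : ℝ → ℝ≥0∞) {s : Set ℝ} (hs : MeasurableSet s) :
    densityMeasure f s = ∫⁻ x in s, f x ∂halfLine :=
  withDensity_apply f hs

theorem densityMeasure_Iic (f : ℝ → ℝ≥0∞) (x : ℝ) : densityMeasure f (Iic x) = hardy f x := by
  rw [densityMeasure_apply f measurableSet_Iic, hardy, Measure.restrict_restrict measurableSet_Iic,
    inter_comm, Ioi_inter_Iic]

theorem densityMeasure_Ioi (f : ℝ → ℝ≥0∞) {x : ℝ} (hx : 0 ≤ x) :
    densityMeasure f (Ioi x) = copson f x := by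
  rw [densityMeasure_apply f measurableSet_Ioi, copson, Measure.restrict_restrict measurableSet_Ioi,
    Ioi_inter_Ioi, sup_eq_left.2 hx]

theorem lintegral_densityMeasure {f : ℝ → ℝ≥0∞} (hf : IsMPlus f) {g : ℝ → ℝ≥0∞} (hg : IsMPlus g) :
    ∫⁻ x, g x ∂densityMeasure f = ∫⁻ x in Ioi 0, g x * f x := by
  rw [densityMeasure, lintegral_withDensity_eq_lintegral_mul₀ hf hg]
  exact lintegral_congr fun x => mul_comm _ _

theorem ae_densityMeasure (f : ℝ → ℝ≥0∞) : ∀ᵐ x ∂densityMeasure f, 0 < x :=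
  (withDensity_absolutelyContinuous halfLine f).ae_le (ae_restrict_mem measurableSet_Ioi)

theorem isCumulative_hardy (f : ℝ → ℝ≥0∞) : IsCumulative (densityMeasure f) (hardy f) := by
  have := isCumulative_Iic (densityMeasure f)
  simpa only [densityMeasure_Iic] using this

theorem hardy_mono (f : ℝ → ℝ≥0∞) : Monotone (hardy f) := fun _ _ h =>
  lintegral_mono_set (Ioc_subset_Ioc_right h)

theorem measurable_hardy (f : ℝ → ℝ≥0∞) : Measurable (hardy f) := (hardy_mono f).measurable

theorem copson_antitone (f : ℝ → ℝ≥0∞) : Antitone (copson f) := fun _ _ h =>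
  lintegral_mono_set (Ioi_subset_Ioi h)

theorem measurable_copson (f : ℝ → ℝ≥0∞) : Measurable (copson f) := (copson_antitone f).measurable

theorem measurable_dualPrimitive (p : ℝ) (v : ℝ → ℝ≥0∞) : Measurable (dualPrimitive p v) :=
  measurable_hardy _

theorem hardy_mono_fun {f g : ℝ → ℝ≥0∞} (h : f ≤ g) (x : ℝ) : hardy f x ≤ hardy g x :=
  lintegral_mono h

theorem hardy_const_mul {c : ℝ≥0∞} (hc : c ≠ ∞) (f : ℝ → ℝ≥0∞) (x : ℝ) :
    hardy (fun t => c * f t) x = c * hardy f x :=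
  lintegral_const_mul' _ _ hc

theorem hardy_of_nonpos (f : ℝ → ℝ≥0∞) {x : ℝ} (hx : x ≤ 0) : hardy f x = 0 := by
  simp [hardy, Ioc_eq_empty (not_lt.2 hx)]

theorem rpow_measure_mul_le_lintegral {μ : Measure ℝ} {q : ℝ} (hq : 0 < q) {S : Set ℝ}
    (hS : MeasurableSet S) (f : ℝ → ℝ≥0∞) (a : ℝ≥0∞) (h : ∀ x ∈ S, a ≤ f x) :
    μ S ^ (1 / q) * a ≤ (∫⁻ x, f x ^ q ∂μ) ^ (1 / q) := by
  calc μ S ^ (1 / q) * a = (∫⁻ _ in S, a ^ q ∂μ) ^ (1 / q) := by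
        rw [setLIntegral_const, ENNReal.mul_rpow_of_nonneg _ _ (by positivity), ← ENNReal.rpow_mul,
          mul_one_div_cancel hq.ne', ENNReal.rpow_one, mul_comm]
    _ ≤ (∫⁻ x in S, f x ^ q ∂μ) ^ (1 / q) := by
        gcongr ?_ ^ (1 / q)
        refine setLIntegral_mono' hS fun x hx => ?_
        gcongr
        exact h x hx
    _ ≤ _ := by
        exact ENNReal.rpow_le_rpow (setLIntegral_le_lintegral _ _) (by positivity)

/-! ### Hölder's inequality and its extremal functions -/

theorem one_div_conjExponent {p : ℝ} (hp : 1 < p) : 1 / p.conjExponent = (p - 1) / p := by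
  have : p - 1 ≠ 0 := by linarith
  rw [Real.conjExponent]; field_simp

theorem one_sub_conjExponent {p : ℝ} (hp : 1 < p) : 1 - p.conjExponent = -(1 / (p - 1)) := by
  have : p - 1 ≠ 0 := by linarith
  rw [Real.conjExponent]; field_simp; ring

/-- Hölder's inequality for the pair of weights `v` and `v ^ (1 - p')`. The norm of `h` has to be
finite because `0 * ∞ = 0`; since `v` is positive almost everywhere, `h` then vanishes almost
everywhere where `v` is infinite. -/
theorem setLIntegral_le_mul_dual {p : ℝ} (hp : 1 < p) {v : ℝ → ℝ≥0∞} (hv : IsWeight v)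
    {h : ℝ → ℝ≥0∞} (hh : IsMPlus h) (hfin : wnorm p v h ≠ ∞) (E : Set ℝ) :
    ∫⁻ x in E, h x ∂halfLine ≤ (∫⁻ x in E, h x ^ p * v x ∂halfLine) ^ (1 / p) *
      (∫⁻ x in E, v x ^ (1 - p.conjExponent) ∂halfLine) ^ (1 / p.conjExponent) := by
  have hp0 : 0 < p := by linarith
  have hp1 : 0 < p - 1 := by linarith
  have hne : ∫⁻ x in Ioi 0, h x ^ p * v x ≠ ∞ := by
    rw [← wnorm_rpow hp0]; exact ENNReal.rpow_ne_top_of_nonneg hp0.le hfin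
  have hm : AEMeasurable (fun x => h x ^ p * v x) halfLine := (hh.pow_const _).mul hv.1
  have hae : ∀ᵐ x ∂halfLine, h x ≤ h x * v x ^ (1 / p) * v x ^ (-(1 / p)) := by
    filter_upwards [hv.2, ae_lt_top' hm hne] with x hx hx'
    by_cases hvt : v x = ∞
    · have : h x = 0 := by
        by_contra h0
        rw [hvt, ENNReal.mul_top (by simp [h0, hp0.not_gt])] at hx'
        exact lt_irrefl _ hx'
      simp [this]
    · rw [mul_assoc, ← ENNReal.rpow_add _ _ hx.ne' hvt, add_neg_cancel, ENNReal.rpow_zero, mul_one]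
  have hconj := Real.HolderConjugate.conjExponent hp
  calc ∫⁻ x in E, h x ∂halfLine
      ≤ ∫⁻ x in E, ((fun x => h x * v x ^ (1 / p)) * fun x => v x ^ (-(1 / p))) x ∂halfLine :=
        lintegral_mono_ae (ae_restrict_of_ae hae)
    _ ≤ _ := ENNReal.lintegral_mul_le_Lp_mul_Lq _ hconj
        ((hh.mul (hv.1.pow_const _)).mono_measure Measure.restrict_le_self)
        ((hv.1.pow_const _).mono_measure Measure.restrict_le_self)
    _ = _ := by
        congr 3 <;> ext x
        · rw [ENNReal.mul_rpow_of_nonneg _ _ hp0.le, ← ENNReal.rpow_mul,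
            one_div_mul_cancel hp0.ne', ENNReal.rpow_one]
        · rw [← ENNReal.rpow_mul, one_sub_conjExponent hp, Real.conjExponent]
          congr 1
          field_simp

theorem hardy_le_wnorm_mul {p : ℝ} (hp : 1 < p) {v : ℝ → ℝ≥0∞} (hv : IsWeight v)
    {h : ℝ → ℝ≥0∞} (hh : IsMPlus h) (hfin : wnorm p v h ≠ ∞) (x : ℝ) :
    hardy h x ≤ wnorm p v h * dualPrimitive p v x ^ (1 / p.conjExponent) := by
  rw [← densityMeasure_Iic, densityMeasure_apply _ measurableSet_Iic, dualPrimitive,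
    ← densityMeasure_Iic, densityMeasure_apply _ measurableSet_Iic]
  refine (setLIntegral_le_mul_dual hp hv hh hfin _).trans ?_
  gcongr
  have : 0 < p := by linarith
  exact ENNReal.rpow_le_rpow (setLIntegral_le_lintegral _ _) (by positivity)

/-- The normalized restriction of `v ^ (1 - p')` to `(0, x]` is extremal for the functional
`h ↦ ∫_0^x h`. -/
theorem exists_extremal {p : ℝ} (hp : 1 < p) {v : ℝ → ℝ≥0∞} (hv : IsWeight v) {x : ℝ}
    (hx : dualPrimitive p v x ≠ ∞) : ∃ h, IsMPlus h ∧ wnorm p v h ≤ 1 ∧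
      ∀ t, x ≤ t → dualPrimitive p v x ^ (1 / p.conjExponent) ≤ hardy h t := by
  have hp0 : 0 < p := by linarith
  have hp1 : 0 < p - 1 := by linarith
  set V := dualPrimitive p v x with hV
  by_cases h0 : V = 0
  · refine ⟨fun _ => 0, aemeasurable_const, by simp [wnorm, hp0], fun t _ => ?_⟩
    rw [h0, one_div_conjExponent hp, ENNReal.zero_rpow_of_pos (by positivity)]
    exact zero_le
  set σ : ℝ → ℝ≥0∞ := fun t => v t ^ (1 - p.conjExponent) with hσ
  have hc : V ^ (-(1 / p)) ≠ ∞ := by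
    simp only [ne_eq, ENNReal.rpow_eq_top_iff, h0, hx, false_and, or_self, not_false_iff]
  have hσm : IsMPlus ((Iic x).indicator σ) := (hv.1.pow_const _).indicator measurableSet_Iic
  refine ⟨fun t => V ^ (-(1 / p)) * (Iic x).indicator σ t, hσm.const_mul _, ?_, fun t ht => ?_⟩
  · have hint : wnorm p v ((Iic x).indicator σ) ^ p = V := by
      rw [wnorm_rpow hp0, hV, dualPrimitive, ← densityMeasure_Iic,
        densityMeasure_apply _ measurableSet_Iic, ← lintegral_indicator measurableSet_Iic]
      refine lintegral_congr_ae ?_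
      filter_upwards [hv.2] with t ht
      by_cases htx : t ∈ Iic x
      · rw [indicator_of_mem htx, hσ]
        simp only
        by_cases hvt : v t = ∞
        · rw [hvt, one_sub_conjExponent hp, ENNReal.top_rpow_of_neg (by simpa using hp1),
            ENNReal.zero_rpow_of_pos hp0, zero_mul]
        · conv_lhs => rw [← ENNReal.rpow_mul]; rhs; rw [← ENNReal.rpow_one (v t)]
          rw [← ENNReal.rpow_add _ _ ht.ne' hvt, one_sub_conjExponent hp]
          congr 1
          field_simp
          ring
      · rw [indicator_of_notMem htx, ENNReal.zero_rpow_of_pos hp0, zero_mul]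
    have hnorm : wnorm p v ((Iic x).indicator σ) = V ^ (1 / p) := by
      rw [← hint, ← ENNReal.rpow_mul, mul_one_div_cancel hp0.ne', ENNReal.rpow_one]
    rw [wnorm_const_mul hp0 _ _ hc, hnorm, ← ENNReal.rpow_add _ _ h0 hx, neg_add_cancel,
      ENNReal.rpow_zero]
  · refine le_trans ?_ (hardy_mono _ ht)
    rw [hardy_const_mul hc]
    have : hardy ((Iic x).indicator σ) x = V := by
      rw [hV, dualPrimitive, hardy, hardy]
      exact setLIntegral_congr_fun measurableSet_Ioc fun t ht =>
        indicator_of_mem (mem_Iic.2 ht.2) σ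
    rw [this]
    conv_rhs => rhs; rw [← ENNReal.rpow_one V]
    rw [← ENNReal.rpow_add _ _ h0 hx, one_div_conjExponent hp]
    apply le_of_eq
    congr 1
    field_simp
    ring

/-! ### The weighted Hardy inequality -/

/-- The constant `sup_x (∫_x^∞ φ)^{1/q} (∫_0^x v^{1-p'})^{1/p'}`, which characterizes the Hardy
inequality from the `L^p` space with weight `v` to the `L^q` space with weight `φ` if `p ≤ q`. -/
noncomputable def muckenhouptConst (p q : ℝ) (v φ : ℝ → ℝ≥0∞) : ℝ≥0∞ :=
  ⨆ x ∈ Ioi (0 : ℝ), copson φ x ^ (1 / q) * dualPrimitive p v x ^ (1 / p.conjExponent)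

/-- The integral constant which characterizes the Hardy inequality from the `L^p` space with weight
`v` to the `L^q` space with weight `φ` if `q < p`. -/
noncomputable def mazyaConst (p q : ℝ) (v φ : ℝ → ℝ≥0∞) : ℝ≥0∞ :=
  (∫⁻ x in Ioi 0, copson φ x ^ (q / (p - q)) * φ x *
    dualPrimitive p v x ^ ((p - 1) * q / (p - q))) ^ ((p - q) / (p * q))

/-- The left-hand side of the Hardy inequality. -/
noncomputable def hardyNorm (q : ℝ) (φ h : ℝ → ℝ≥0∞) : ℝ≥0∞ :=
  (∫⁻ x in Ioi 0, hardy h x ^ q * φ x) ^ (1 / q)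

theorem lintegral_dual_mul_tail {p q : ℝ} (hp : 1 < p) (hqp : q < p) (v : ℝ → ℝ≥0∞)
    {φ : ℝ → ℝ≥0∞} (hφ : IsMPlus φ) :
    ∫⁻ x, (dualPrimitive p v x ^ (1 / p.conjExponent)) ^ (p * q / (p - q)) *
      densityMeasure φ (Ioi x) ^ (q / (p - q)) ∂densityMeasure φ =
    ∫⁻ x in Ioi 0, copson φ x ^ (q / (p - q)) * φ x *
      dualPrimitive p v x ^ ((p - 1) * q / (p - q)) := by
  have hp0 : p ≠ 0 := by linarith
  have hd : p - q ≠ 0 := by linarith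
  have hm : Measurable fun x => (dualPrimitive p v x ^ (1 / p.conjExponent)) ^ (p * q / (p - q)) *
      densityMeasure φ (Ioi x) ^ (q / (p - q)) :=
    Measurable.mul (((measurable_dualPrimitive p v).pow_const _).pow_const _)
      ((isCumulative_Ioi (densityMeasure φ)).measurable.pow_const _)
  rw [lintegral_densityMeasure hφ hm.aemeasurable]
  refine setLIntegral_congr_fun measurableSet_Ioi fun x hx => ?_
  rw [densityMeasure_Ioi φ (le_of_lt hx), ← ENNReal.rpow_mul, one_div_conjExponent hp,
    show (p - 1) / p * (p * q / (p - q)) = (p - 1) * q / (p - q) by field_simp]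
  ring

/-- The dyadic level sets of `∫_0^x h` reduce the Hardy inequality to a bound for block sequences:
the mass of `h` on a block is comparable to the values of the primitive on the next block. -/
theorem hardyNorm_le_of_blockBound {p q : ℝ} (hp : 1 < p) (hq : 0 < q) {v : ℝ → ℝ≥0∞}
    (hv : IsWeight v) (hV : ∀ x : ℝ, 0 < x → dualPrimitive p v x < ∞) {φ : ℝ → ℝ≥0∞}
    (hφ : IsMPlus φ) {D : ℝ≥0∞}
    (hD : BlockBound p q (densityMeasure φ) (fun x => dualPrimitive p v x ^ (1 / p.conjExponent)) D)
    {h : ℝ → ℝ≥0∞} (hh : IsMPlus h) (hfin : wnorm p v h ≠ ∞) :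
    hardyNorm q φ h ≤ 4 * D * wnorm p v h := by
  have hp0 : 0 < p := by linarith
  have hpc : 0 ≤ 1 / p.conjExponent := by
    have : 0 < p - 1 := by linarith
    rw [one_div_conjExponent hp]; positivity
  have hM := isCumulative_hardy h
  set μ := densityMeasure φ with hμ
  have hH : ∀ x, hardy h x ≠ ∞ := fun x => by
    rcases le_or_gt x 0 with hx | hx
    · simp [hardy_of_nonpos h hx]
    · exact ne_top_of_le_ne_top (ENNReal.mul_ne_top hfin
        (ENNReal.rpow_ne_top_of_nonneg hpc (hV x hx).ne)) (hardy_le_wnorm_mul hp hv hh hfin x)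
  set E := dyadicBlock (hardy h) with hE
  have hEm : ∀ k, MeasurableSet (E k) := measurableSet_dyadicBlock hM.measurable
  set g : ℤ → ℝ≥0∞ := fun k => ∫⁻ x in E (k - 1), h x ^ p * v x ∂halfLine with hg
  have hblock := hD E (fun k => 2 ^ (k - 1)) g hEm (fun k x hx => by
      by_contra hx0
      have := hx.1
      rw [hardy_of_nonpos h (not_lt.1 hx0), nonpos_iff_eq_zero] at this
      exact (ENNReal.zpow_pos (by simp) (by simp) k).ne' this) (pairwise_disjoint_dyadicBlock _)
    (fun k x hx => by
      have h1 := hM.le_measure_level x (2 ^ (k - 1)) (by rw [two_mul_two_zpow_pred]; exact hx.1)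
        (hH x).lt_top
      change _ ≤ densityMeasure h (E (k - 1)) at h1
      rw [densityMeasure_apply _ (hEm (k - 1))] at h1
      refine h1.trans ((setLIntegral_le_mul_dual hp hv hh hfin _).trans ?_)
      rw [mul_comm]
      refine mul_le_mul' (ENNReal.rpow_le_rpow ?_ hpc) le_rfl
      rw [dualPrimitive, ← densityMeasure_Iic, densityMeasure_apply _ measurableSet_Iic]
      refine lintegral_mono_set fun t ht => ?_
      exact (hardy_mono h).reflect_lt (lt_of_mem_dyadicBlock (by linarith) ht hx) |>.le)
  have hsum : ∑' k, g k ≤ wnorm p v h ^ p := by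
    rw [wnorm_rpow hp0, ← (Equiv.addRight (1 : ℤ)).tsum_eq g]
    simp only [hg, Equiv.coe_addRight, add_sub_cancel_right]
    exact tsum_lintegral_dyadicBlock_le hM.measurable _
  have hint : ∫⁻ x in Ioi 0, hardy h x ^ q * φ x ≤ (4 * D * wnorm p v h) ^ q := by
    calc _ = ∫⁻ x, hardy h x ^ q ∂μ :=
          (lintegral_densityMeasure hφ (hM.measurable.pow_const _).aemeasurable).symm
      _ ≤ ∑' k, ∫⁻ x in E k, hardy h x ^ q ∂μ :=
          lintegral_le_tsum_dyadicBlock hM.measurable (Filter.Eventually.of_forall fun x hx => by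
            rw [hx.resolve_right (hH x), ENNReal.zero_rpow_of_pos hq])
      _ ≤ ∑' k, 4 ^ q * ((2 ^ (k - 1)) ^ q * μ (E k)) := by
          refine ENNReal.tsum_le_tsum fun k => ?_
          calc _ ≤ ∫⁻ _ in E k, (4 * 2 ^ (k - 1)) ^ q ∂μ := by
                refine setLIntegral_mono' (hEm k) fun x hx => ?_
                gcongr
                have := hx.2.le
                rw [← two_mul_two_zpow_pred, ← mul_assoc] at this
                norm_num at this
                exact this
            _ = _ := by
                rw [setLIntegral_const, ENNReal.mul_rpow_of_nonneg _ _ hq.le, mul_assoc]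
      _ ≤ 4 ^ q * (D ^ q * (wnorm p v h ^ p) ^ (q / p)) := by
          rw [ENNReal.tsum_mul_left]
          gcongr
          exact hblock.trans (by gcongr)
      _ = _ := by
          rw [← ENNReal.rpow_mul, mul_div_cancel₀ q hp0.ne', ENNReal.mul_rpow_of_nonneg _ _ hq.le,
            ENNReal.mul_rpow_of_nonneg _ _ hq.le, mul_assoc]
  rw [hardyNorm, one_div, ENNReal.rpow_inv_le_iff hq]
  exact hint

theorem hardyNorm_le_muckenhouptConst {p q : ℝ} (hp : 1 < p) (hpq : p ≤ q) {v : ℝ → ℝ≥0∞}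
    (hv : IsWeight v) (hV : ∀ x : ℝ, 0 < x → dualPrimitive p v x < ∞) {φ : ℝ → ℝ≥0∞}
    (hφ : IsMPlus φ) {h : ℝ → ℝ≥0∞} (hh : IsMPlus h) (hfin : wnorm p v h ≠ ∞) :
    hardyNorm q φ h ≤ 4 * muckenhouptConst p q v φ * wnorm p v h := by
  refine hardyNorm_le_of_blockBound hp (by linarith) hv hV hφ ?_ hh hfin
  refine blockBound_of_le (isCumulative_Ioi (densityMeasure φ)) (by linarith) hpq fun x hx => ?_
  rw [densityMeasure_Ioi φ hx.le]
  exact le_iSup₂_of_le x hx le_rfl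

theorem hardyNorm_le_mazyaConst {p q : ℝ} (hp : 1 < p) (hq : 0 < q) (hqp : q < p) {v : ℝ → ℝ≥0∞}
    (hv : IsWeight v) (hV : ∀ x : ℝ, 0 < x → dualPrimitive p v x < ∞) {φ : ℝ → ℝ≥0∞}
    (hφ : IsMPlus φ) {h : ℝ → ℝ≥0∞} (hh : IsMPlus h) (hfin : wnorm p v h ≠ ∞) :
    hardyNorm q φ h ≤ 4 * (2 ^ (1 / q) * mazyaConst p q v φ) * wnorm p v h := by
  refine hardyNorm_le_of_blockBound hp hq hv hV hφ ?_ hh hfin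
  have := blockBound_of_lt (isCumulative_Ioi (densityMeasure φ)) hq hqp
    (((measurable_dualPrimitive p v).pow_const (1 / p.conjExponent)))
  rwa [lintegral_dual_mul_tail hp hqp v hφ] at this

theorem mazyaConst_le_opNorm {p q : ℝ} (hp : 1 < p) (hq : 0 < q) (hqp : q < p) {v : ℝ → ℝ≥0∞}
    (hv : IsWeight v) (hV : ∀ x : ℝ, 0 < x → dualPrimitive p v x < ∞) {φ : ℝ → ℝ≥0∞}
    (hφ : IsMPlus φ) :
    mazyaConst p q v φ ≤ (2 ^ q * 4) ^ (1 / q) * opNorm p v (hardyNorm q φ) := by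
  have hΛ : (fun h => (∫⁻ x, hardy h x ^ q ∂densityMeasure φ) ^ (1 / q)) = hardyNorm q φ := by
    funext h
    rw [hardyNorm, lintegral_densityMeasure hφ ((measurable_hardy h).pow_const _).aemeasurable]
  have key := lintegral_le_opNorm hq hqp (isCumulative_Ioi (densityMeasure φ)) hv.1
    (fun x h => hardy h x) (fun x f g hfg => hardy_mono_fun hfg x)
    (fun x c h hc => hardy_const_mul hc h x)
    (fun x y hxy h => hardy_mono h (le_of_not_ge fun hyx =>
      absurd hxy (not_lt.2 (measure_mono (Ioi_subset_Ioi hyx)))))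
    (fun y h => rpow_measure_mul_le_lintegral hq measurableSet_Ioi _ _
      fun x hx => hardy_mono h (le_of_lt hx))
    (fun x => dualPrimitive p v x ^ (1 / p.conjExponent)) (fun x => by
      have hfin : dualPrimitive p v x ≠ ∞ := by
        rcases le_or_gt x 0 with hx | hx
        · rw [dualPrimitive, hardy_of_nonpos _ hx]; simp
        · exact (hV x hx).ne
      obtain ⟨h, hh, h1, hx⟩ := exists_extremal hp hv hfin
      exact (hx x le_rfl).trans (le_opNorm (Λ := fun h => hardy h x) hh h1))
  rw [hΛ, lintegral_dual_mul_tail hp hqp v hφ] at key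
  exact key

/-! ### The iterated operator -/

/-- The norm of `∫_0^t h` in the `L^r` space with weight `u` on `(x,∞)`. -/
noncomputable def tailNorm (r : ℝ) (u : ℝ → ℝ≥0∞) (x : ℝ) (h : ℝ → ℝ≥0∞) : ℝ≥0∞ :=
  (∫⁻ t in Ioi x, hardy h t ^ r * u t) ^ (1 / r)

/-- The constant with which the iterated operator is controlled by Hardy operators; only its finiteness
and positivity matter. -/
noncomputable def iterConst (q r : ℝ) : ℝ≥0∞ :=
  ((4 * 2 ^ r) ^ (q / r) * 2 ^ (q / r)) ^ (1 / q) * 2 ^ (1 / q)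

theorem iterConst_ne_top {q r : ℝ} (hq : 0 < q) (hr : 0 < r) : iterConst q r ≠ ∞ := by
  refine ENNReal.mul_ne_top (ENNReal.rpow_ne_top_of_nonneg (by positivity) (ENNReal.mul_ne_top
    (ENNReal.rpow_ne_top_of_nonneg (by positivity) (ENNReal.mul_ne_top (by simp)
      (ENNReal.rpow_ne_top_of_nonneg hr.le (by simp))))
    (ENNReal.rpow_ne_top_of_nonneg (by positivity) (by simp))))
    (ENNReal.rpow_ne_top_of_nonneg (by positivity) (by simp))

theorem iterConst_ne_zero {q r : ℝ} (hq : 0 < q) (hr : 0 < r) : iterConst q r ≠ 0 := by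
  have h1 : (4 * 2 ^ r : ℝ≥0∞) ^ (q / r) ≠ 0 := by
    rw [ne_eq, ENNReal.rpow_eq_zero_iff_of_pos (by positivity)]
    simp [hr.not_gt]
  have h2 : ∀ a : ℝ, 0 < a → (2 : ℝ≥0∞) ^ a ≠ 0 := fun a ha => by
    simp [ENNReal.rpow_eq_zero_iff_of_pos ha]
  refine mul_ne_zero ?_ (h2 _ (by positivity))
  rw [ne_eq, ENNReal.rpow_eq_zero_iff_of_pos (by positivity)]
  exact mul_ne_zero h1 (h2 _ (by positivity))

/-- The iterated operator is controlled by a Hardy inequality with weight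
`(∫_x^∞ u)^{q/r} w(x)`, together with the Hardy inequalities on the intervals `(x,∞)` with weight
`u`, with constants `J x`. On a dyadic level set of `x ↦ ∫_x^∞ (∫_0^t h)^r u` that function
is comparable to the integral over the following level set, where `∫_0^t h` is split at a
point of the former. -/
theorem iterated_le_of_blockBound {p q r : ℝ} (hp : 1 < p) (hq : 0 < q) (hr : 0 < r)
    {u v w : ℝ → ℝ≥0∞} (hu : IsMPlus u) (hw : IsMPlus w) {J : ℝ → ℝ≥0∞}
    (hJ : ∀ x, 0 < x → ∀ h, IsMPlus h → wnorm p v h ≠ ∞ → tailNorm r u x h ≤ J x * wnorm p v h)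
    (hJfin : ∀ x, 0 < x → J x ≠ ∞) {D : ℝ≥0∞} (hD : BlockBound p q (densityMeasure w) J D)
    {h : ℝ → ℝ≥0∞} (hh : IsMPlus h) (hfin : wnorm p v h ≠ ∞) :
    iterated q r u w h ≤ iterConst q r *
      (hardyNorm q (fun x => copson u x ^ (q / r) * w x) h + D * 2 ^ (1 / p) * wnorm p v h) := by
  rw [iterConst]
  have hp0 : 0 < p := by linarith
  have hqr : 0 < q / r := by positivity
  set ν := densityMeasure fun t => hardy h t ^ r * u t with hν
  set M : ℝ → ℝ≥0∞ := fun x => ν (Ioi x) with hMdef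
  have hM : IsCumulative ν M := isCumulative_Ioi ν
  have hMx : ∀ x, 0 < x → M x = ∫⁻ t in Ioi x, hardy h t ^ r * u t := fun x hx =>
    densityMeasure_Ioi _ hx.le
  have hMfin : ∀ x, 0 < x → M x ≠ ∞ := fun x hx => by
    have := ne_top_of_le_ne_top (ENNReal.mul_ne_top (hJfin x hx) hfin) (hJ x hx h hh hfin)
    rw [tailNorm, ← hMx x hx] at this
    intro htop
    exact this (by rw [htop, ENNReal.top_rpow_of_pos (by positivity)])
  have hManti : ∀ {x y}, M x < M y → y < x := fun {x y} hxy => lt_of_not_ge fun hyx =>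
    absurd hxy (not_lt.2 (measure_mono (Ioi_subset_Ioi hyx)))
  set E := dyadicBlock M with hE
  have hEm : ∀ k, MeasurableSet (E k) := measurableSet_dyadicBlock hM.measurable
  set f : ℤ → ℝ → ℝ≥0∞ := fun k => (E k ∪ E (k - 1)).indicator h with hf
  have hfm : ∀ k, IsMPlus (f k) := fun k => hh.indicator ((hEm k).union (hEm (k - 1)))
  have hfp : ∀ k, wnorm p v (f k) ^ p ≤
      (∫⁻ x in E k, h x ^ p * v x ∂halfLine) + ∫⁻ x in E (k - 1), h x ^ p * v x ∂halfLine := by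
    intro k
    rw [wnorm_rpow hp0]
    calc _ ≤ ∫⁻ x in E k ∪ E (k - 1), h x ^ p * v x ∂halfLine := by
          rw [← lintegral_indicator ((hEm k).union (hEm (k - 1)))]
          refine lintegral_mono fun x => ?_
          by_cases hx : x ∈ E k ∪ E (k - 1)
          · rw [hf]; simp only; rw [indicator_of_mem hx, indicator_of_mem hx]
          · rw [hf]; simp only
            rw [indicator_of_notMem hx, ENNReal.zero_rpow_of_pos hp0, zero_mul]; exact zero_le
      _ ≤ _ := lintegral_union_le _ _ _
  have hfsum : ∑' k, wnorm p v (f k) ^ p ≤ 2 * wnorm p v h ^ p := by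
    calc _ ≤ ∑' k, ((∫⁻ x in E k, h x ^ p * v x ∂halfLine) +
          ∫⁻ x in E (k - 1), h x ^ p * v x ∂halfLine) := ENNReal.tsum_le_tsum hfp
      _ = (∑' k, ∫⁻ x in E k, h x ^ p * v x ∂halfLine) +
          ∑' k, ∫⁻ x in E k, h x ^ p * v x ∂halfLine := by
          rw [ENNReal.tsum_add]
          congr 1
          exact (Equiv.subRight (1 : ℤ)).tsum_eq fun k => ∫⁻ x in E k, h x ^ p * v x ∂halfLine
      _ ≤ _ := by
          rw [two_mul, wnorm_rpow hp0]
          exact add_le_add (tsum_lintegral_dyadicBlock_le hM.measurable _)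
            (tsum_lintegral_dyadicBlock_le hM.measurable _)
  have hffin : ∀ k, wnorm p v (f k) ≠ ∞ := fun k htop => by
    have h1 := (ENNReal.le_tsum k).trans hfsum
    rw [htop, ENNReal.top_rpow_of_pos hp0, top_le_iff] at h1
    exact ENNReal.mul_ne_top (by simp) (ENNReal.rpow_ne_top_of_nonneg hp0.le hfin) h1
  set n : ℤ → ℝ≥0∞ := fun k => (∫⁻ t in E (k - 1), hardy (f k) t ^ r * u t ∂halfLine) ^ (1 / r)
    with hn
  have hsub : ∀ k, ∀ x ∈ E k, E (k - 1) ⊆ Ioi x := fun k x hx t ht =>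
    hManti (lt_of_mem_dyadicBlock (by linarith) ht hx)
  have hrestrict : ∀ k, ∀ x ∈ E k, 0 < x → halfLine.restrict (E (k - 1)) ≤ volume.restrict (Ioi x) :=
    fun k x hx hx0 => by
      rw [Measure.restrict_restrict (hEm _)]
      exact Measure.restrict_mono (inter_subset_left.trans (hsub k x hx)) le_rfl
  have hblock := hD (fun k => E k ∩ Ioi 0) n (fun k => wnorm p v (f k) ^ p)
    (fun k => (hEm k).inter measurableSet_Ioi) (fun k => inter_subset_right)
    (fun j k hjk => (pairwise_disjoint_dyadicBlock M hjk).mono inter_subset_left inter_subset_left)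
    (fun k x hx => by
      rw [← ENNReal.rpow_mul, mul_one_div_cancel hp0.ne', ENNReal.rpow_one]
      refine le_trans ?_ (hJ x hx.2 (f k) (hfm k) (hffin k))
      refine ENNReal.rpow_le_rpow ?_ (by positivity)
      exact lintegral_mono' (hrestrict k x hx.1 hx.2) le_rfl)
  -- the pointwise estimate on a level set
  have hpoint : ∀ k, ∀ x ∈ E k, 0 < x → M x ^ (q / r) ≤ (4 * 2 ^ r) ^ (q / r) * 2 ^ (q / r) *
      (hardy h x ^ q * copson u x ^ (q / r) + n k ^ q) := by
    intro k x hx hx0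
    have hsplit : ∀ t ∈ E (k - 1), hardy h t ≤ hardy h x + hardy (f k) t := by
      intro t ht
      have hxt : x < t := hsub k x hx ht
      rw [hardy, hardy, hardy, ← Ioc_union_Ioc_eq_Ioc hx0.le hxt.le]
      refine (lintegral_union_le _ _ _).trans ?_
      refine add_le_add le_rfl ?_
      rw [Ioc_union_Ioc_eq_Ioc hx0.le hxt.le]
      calc ∫⁻ y in Ioc x t, h y = ∫⁻ y in Ioc x t, f k y := by
            refine setLIntegral_congr_fun measurableSet_Ioc fun y hy => ?_
            have hxy : M y ≤ M x := measure_mono (Ioi_subset_Ioi hy.1.le)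
            have hyt : M t ≤ M y := measure_mono (Ioi_subset_Ioi hy.2)
            have hmem : y ∈ E k ∪ E (k - 1) := by
              rcases le_or_gt (2 ^ k) (M y) with h1 | h1
              · exact Or.inl ⟨h1, hxy.trans_lt hx.2⟩
              · exact Or.inr ⟨ht.1.trans hyt, by rwa [two_mul_two_zpow_pred]⟩
            exact (indicator_of_mem hmem h).symm
        _ ≤ _ := lintegral_mono_set (Ioc_subset_Ioc_left hx0.le)
    have hmass : 2 ^ (k - 1) ≤ ν (E (k - 1)) :=
      hM.le_measure_level x (2 ^ (k - 1)) (by rw [two_mul_two_zpow_pred]; exact hx.1)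
        (hMfin x hx0).lt_top
    have hνE : ν (E (k - 1)) ≤ 2 ^ r * (hardy h x ^ r * copson u x + n k ^ r) := by
      have hum : AEMeasurable u (halfLine.restrict (E (k - 1))) :=
        hu.mono_measure Measure.restrict_le_self
      calc ν (E (k - 1)) = ∫⁻ t in E (k - 1), hardy h t ^ r * u t ∂halfLine :=
            densityMeasure_apply _ (hEm _)
        _ ≤ ∫⁻ t in E (k - 1), 2 ^ r * (hardy h x ^ r * u t + hardy (f k) t ^ r * u t) ∂halfLine := by
            refine setLIntegral_mono' (hEm _) fun t ht => ?_
            rw [← add_mul, ← mul_assoc]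
            gcongr
            exact (ENNReal.rpow_le_rpow (hsplit t ht) hr.le).trans
              (ENNReal.add_rpow_le_two_rpow_mul_rpow_add_rpow _ _ hr.le)
        _ = 2 ^ r * (hardy h x ^ r * (∫⁻ t in E (k - 1), u t ∂halfLine) + n k ^ r) := by
            rw [lintegral_const_mul' _ _ (by simp), lintegral_add_left' (hum.const_mul _),
              lintegral_const_mul'' _ hum, hn]
            simp only
            rw [← ENNReal.rpow_mul, one_div_mul_cancel hr.ne', ENNReal.rpow_one]
        _ ≤ _ := by
            gcongr
            exact lintegral_mono' (hrestrict k x hx hx0) le_rfl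
    calc M x ^ (q / r) ≤ (4 * 2 ^ r * (hardy h x ^ r * copson u x + n k ^ r)) ^ (q / r) := by
          gcongr
          calc M x ≤ 2 * 2 ^ k := hx.2.le
            _ = 4 * 2 ^ (k - 1) := by
                rw [← two_mul_two_zpow_pred, ← mul_assoc]; norm_num
            _ ≤ 4 * (2 ^ r * (hardy h x ^ r * copson u x + n k ^ r)) := by
                gcongr; exact hmass.trans hνE
            _ = _ := by ring
      _ = (4 * 2 ^ r) ^ (q / r) * (hardy h x ^ r * copson u x + n k ^ r) ^ (q / r) :=
          ENNReal.mul_rpow_of_nonneg _ _ hqr.le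
      _ ≤ (4 * 2 ^ r) ^ (q / r) * (2 ^ (q / r) *
          ((hardy h x ^ r * copson u x) ^ (q / r) + (n k ^ r) ^ (q / r))) := by
          gcongr
          exact ENNReal.add_rpow_le_two_rpow_mul_rpow_add_rpow _ _ hqr.le
      _ = _ := by
          rw [ENNReal.mul_rpow_of_nonneg (hardy h x ^ r) _ hqr.le, ← ENNReal.rpow_mul (hardy h x),
            ← ENNReal.rpow_mul (n k), mul_div_cancel₀ q hr.ne', mul_assoc]
  set K : ℝ≥0∞ := (4 * 2 ^ r) ^ (q / r) * 2 ^ (q / r) with hK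
  have hKfin : K ≠ ∞ := by
    refine ENNReal.mul_ne_top (ENNReal.rpow_ne_top_of_nonneg hqr.le
      (ENNReal.mul_ne_top (by simp) (ENNReal.rpow_ne_top_of_nonneg hr.le (by simp))))
      (ENNReal.rpow_ne_top_of_nonneg hqr.le (by simp))
  set μ := densityMeasure w with hμ
  set G : ℝ → ℝ≥0∞ := fun x => hardy h x ^ q * copson u x ^ (q / r) with hG
  have hGm : Measurable G := ((measurable_hardy h).pow_const _).mul ((measurable_copson u).pow_const _)
  have hGint : ∫⁻ x, G x ∂μ = hardyNorm q (fun x => copson u x ^ (q / r) * w x) h ^ q := by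
    rw [hardyNorm, ← ENNReal.rpow_mul, one_div_mul_cancel hq.ne', ENNReal.rpow_one,
      lintegral_densityMeasure hw hGm.aemeasurable]
    exact lintegral_congr fun x => mul_assoc _ _ _
  have hint : ∫⁻ x, M x ^ (q / r) ∂μ ≤ K * ((∫⁻ x, G x ∂μ) +
      D ^ q * (2 * wnorm p v h ^ p) ^ (q / p)) := by
    calc _ ≤ ∑' k, ∫⁻ x in E k, M x ^ (q / r) ∂μ := by
          refine lintegral_le_tsum_dyadicBlock hM.measurable ?_
          filter_upwards [ae_densityMeasure w] with x hx hx'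
          rw [hx'.resolve_right (hMfin x hx), ENNReal.zero_rpow_of_pos hqr]
      _ ≤ ∑' k, K * ((∫⁻ x in E k, G x ∂μ) + n k ^ q * μ (E k ∩ Ioi 0)) := by
          refine ENNReal.tsum_le_tsum fun k => ?_
          have hEk : μ (E k) = μ (E k ∩ Ioi 0) := measure_congr <| by
            filter_upwards [ae_densityMeasure w] with x hx
            exact propext ⟨fun h => ⟨h, hx⟩, fun h => h.1⟩
          calc _ ≤ ∫⁻ x in E k, K * (G x + n k ^ q) ∂μ := by
                refine lintegral_mono_ae ?_
                filter_upwards [ae_restrict_mem (hEm k), ae_restrict_of_ae (ae_densityMeasure w)]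
                  with x hx hx0 using hpoint k x hx hx0
            _ = _ := by
                rw [lintegral_const_mul' _ _ hKfin, lintegral_add_right _ measurable_const,
                  setLIntegral_const, hEk]
      _ = K * ((∑' k, ∫⁻ x in E k, G x ∂μ) + ∑' k, n k ^ q * μ (E k ∩ Ioi 0)) := by
          rw [ENNReal.tsum_mul_left, ENNReal.tsum_add]
      _ ≤ _ := by
          gcongr
          · exact tsum_lintegral_dyadicBlock_le hM.measurable _
          · exact hblock.trans (by gcongr)
  have hiter : iterated q r u w h = (∫⁻ x, M x ^ (q / r) ∂μ) ^ (1 / q) := by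
    rw [iterated, lintegral_densityMeasure hw (hM.measurable.pow_const _).aemeasurable]
    congr 1
    exact setLIntegral_congr_fun measurableSet_Ioi fun x hx => by rw [hMx x hx]
  have hq1 : 0 ≤ 1 / q := by positivity
  rw [hiter]
  calc _ ≤ (K * (hardyNorm q (fun x => copson u x ^ (q / r) * w x) h ^ q +
        (D * 2 ^ (1 / p) * wnorm p v h) ^ q)) ^ (1 / q) := by
        gcongr ?_ ^ (1 / q)
        refine hint.trans (le_of_eq ?_)
        rw [hGint, ENNReal.mul_rpow_of_nonneg _ _ (by positivity : 0 ≤ q / p), ← ENNReal.rpow_mul,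
          mul_div_cancel₀ q hp0.ne', ENNReal.mul_rpow_of_nonneg _ _ hq.le,
          ENNReal.mul_rpow_of_nonneg _ _ hq.le, ← ENNReal.rpow_mul, one_div_mul_eq_div,
          mul_assoc (D ^ q)]
    _ ≤ _ := by
        rw [ENNReal.mul_rpow_of_nonneg _ _ hq1, mul_assoc (K ^ (1 / q))]
        refine mul_le_mul' le_rfl
          ((ENNReal.add_rpow_le_two_rpow_mul_rpow_add_rpow _ _ hq1).trans (le_of_eq ?_))
        rw [← ENNReal.rpow_mul, ← ENNReal.rpow_mul, mul_one_div_cancel hq.ne', ENNReal.rpow_one,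
          ENNReal.rpow_one]

/-! ### Hardy inequalities on the intervals `(x,∞)` -/

/-- Up to the factor `c`, the number `T x` is the best constant in the Hardy inequality with weight
`u` on `(x,∞)`. -/
structure IsTailConst (p r : ℝ) (u v : ℝ → ℝ≥0∞) (c : ℝ≥0∞) (T : ℝ → ℝ≥0∞) : Prop where
  antitone : Antitone T
  tailNorm_le : ∀ x, 0 < x → ∀ h, IsMPlus h → wnorm p v h ≠ ∞ →
    tailNorm r u x h ≤ c * T x * wnorm p v h
  le_opNorm : ∀ x, 0 < x → T x ≤ c * opNorm p v (tailNorm r u x)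

theorem opNorm_mono {p : ℝ} {v : ℝ → ℝ≥0∞} {Λ Λ' : (ℝ → ℝ≥0∞) → ℝ≥0∞} (h : ∀ f, Λ f ≤ Λ' f) :
    opNorm p v Λ ≤ opNorm p v Λ' :=
  iSup₂_mono fun f _ => h f

theorem muckenhouptConst_le_opNorm {p q : ℝ} (hp : 1 < p) (hq : 0 < q) {v : ℝ → ℝ≥0∞}
    (hv : IsWeight v) (hV : ∀ x : ℝ, 0 < x → dualPrimitive p v x < ∞) {φ : ℝ → ℝ≥0∞}
    (hφ : IsMPlus φ) : muckenhouptConst p q v φ ≤ opNorm p v (hardyNorm q φ) := by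
  refine iSup₂_le fun x hx => ?_
  obtain ⟨h, hh, h1, hxt⟩ := exists_extremal hp hv (hV x hx).ne
  refine le_trans ?_ (le_opNorm hh h1)
  have := rpow_measure_mul_le_lintegral (μ := densityMeasure φ) hq (measurableSet_Ioi (a := x))
    (hardy h) _ fun t ht => hxt t (le_of_lt ht)
  rwa [densityMeasure_Ioi φ (le_of_lt hx), lintegral_densityMeasure hφ
    ((measurable_hardy h).pow_const _).aemeasurable] at this

theorem tailNorm_eq_hardyNorm {r : ℝ} (u : ℝ → ℝ≥0∞) {x : ℝ} (hx : 0 ≤ x) (h : ℝ → ℝ≥0∞) :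
    tailNorm r u x h = hardyNorm r ((Ioi x).indicator u) h := by
  rw [tailNorm, hardyNorm]
  congr 1
  have : ∀ t, hardy h t ^ r * (Ioi x).indicator u t =
      (Ioi x).indicator (fun t => hardy h t ^ r * u t) t := fun t => by
    by_cases ht : t ∈ Ioi x
    · rw [indicator_of_mem ht, indicator_of_mem ht]
    · rw [indicator_of_notMem ht, indicator_of_notMem ht, mul_zero]
  simp only [this]
  rw [lintegral_indicator measurableSet_Ioi, Measure.restrict_restrict measurableSet_Ioi,
    Ioi_inter_Ioi, sup_eq_left.2 hx]

theorem copson_indicator (u : ℝ → ℝ≥0∞) (x t : ℝ) :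
    copson ((Ioi x).indicator u) t = copson u (max t x) := by
  rw [copson, lintegral_indicator measurableSet_Ioi, Measure.restrict_restrict measurableSet_Ioi,
    Ioi_inter_Ioi, copson, sup_comm]

theorem muckenhouptConst_indicator {p r : ℝ} (hp : 1 < p) (u v : ℝ → ℝ≥0∞) {x : ℝ}
    (hx : 0 < x) : muckenhouptConst p r v ((Ioi x).indicator u) =
      ⨆ t ∈ Ici x, copson u t ^ (1 / r) * dualPrimitive p v t ^ (1 / p.conjExponent) := by
  have hpc : 0 ≤ 1 / p.conjExponent := by
    have : 0 < p - 1 := by linarith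
    rw [one_div_conjExponent hp]; positivity
  refine le_antisymm (iSup₂_le fun t _ => ?_) (iSup₂_le fun t ht => ?_)
  · rw [copson_indicator]
    refine le_iSup₂_of_le (max t x) (le_max_right t x) (mul_le_mul' le_rfl ?_)
    exact ENNReal.rpow_le_rpow (hardy_mono _ (le_max_left _ _)) hpc
  · refine le_iSup₂_of_le t (hx.trans_le ht) ?_
    rw [copson_indicator, max_eq_left ht]

theorem mazyaConst_indicator (p r : ℝ) (u v : ℝ → ℝ≥0∞) {x : ℝ} (hx : 0 < x) :
    mazyaConst p r v ((Ioi x).indicator u) = innerInt p r u v x ^ ((p - r) / (p * r)) := by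
  rw [mazyaConst, innerInt]
  congr 1
  have : ∀ t, copson ((Ioi x).indicator u) t ^ (r / (p - r)) * (Ioi x).indicator u t *
      dualPrimitive p v t ^ ((p - 1) * r / (p - r)) = (Ioi x).indicator (fun t =>
        copson u t ^ (r / (p - r)) * u t * dualPrimitive p v t ^ ((p - 1) * r / (p - r))) t := by
    intro t
    by_cases ht : t ∈ Ioi x
    · rw [indicator_of_mem ht, indicator_of_mem ht, copson_indicator, max_eq_left (le_of_lt ht)]
    · rw [indicator_of_notMem ht, indicator_of_notMem ht, mul_zero, zero_mul]
  simp only [this]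
  rw [lintegral_indicator measurableSet_Ioi, Measure.restrict_restrict measurableSet_Ioi,
    Ioi_inter_Ioi, sup_eq_left.2 hx.le]

theorem isTailConst_of_le {p r : ℝ} (hp : 1 < p) (hpr : p ≤ r) {u v : ℝ → ℝ≥0∞} (hu : IsMPlus u)
    (hv : IsWeight v) (hV : ∀ x : ℝ, 0 < x → dualPrimitive p v x < ∞) :
    IsTailConst p r u v 4 fun x =>
      ⨆ t ∈ Ici x, copson u t ^ (1 / r) * dualPrimitive p v t ^ (1 / p.conjExponent) where
  antitone x y hxy := biSup_mono fun t ht => (hxy.trans ht : x ≤ t)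
  tailNorm_le x hx h hh hfin := by
    rw [tailNorm_eq_hardyNorm u hx.le, ← muckenhouptConst_indicator hp u v hx]
    exact hardyNorm_le_muckenhouptConst hp hpr hv hV (hu.indicator measurableSet_Ioi) hh hfin
  le_opNorm x hx := by
    have hr : 0 < r := by linarith
    rw [← muckenhouptConst_indicator hp u v hx]
    have e : tailNorm r u x = hardyNorm r ((Ioi x).indicator u) :=
      funext fun h => tailNorm_eq_hardyNorm u hx.le h
    rw [e]
    refine (muckenhouptConst_le_opNorm hp hr hv hV (hu.indicator measurableSet_Ioi)).trans ?_
    exact le_mul_of_one_le_left zero_le (by norm_num)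

theorem isTailConst_of_lt {p r : ℝ} (hp : 1 < p) (hr : 0 < r) (hrp : r < p) {u v : ℝ → ℝ≥0∞}
    (hu : IsMPlus u) (hv : IsWeight v) (hV : ∀ x : ℝ, 0 < x → dualPrimitive p v x < ∞) :
    IsTailConst p r u v (4 * 2 ^ (1 / r) + (2 ^ r * 4) ^ (1 / r)) fun x =>
      innerInt p r u v x ^ ((p - r) / (p * r)) where
  antitone x y hxy := by
    have h1 : 0 < p - r := by linarith
    have h2 : 0 < p := by linarith
    exact ENNReal.rpow_le_rpow (lintegral_mono_set (Ioi_subset_Ioi hxy)) (by positivity)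
  tailNorm_le x hx h hh hfin := by
    rw [tailNorm_eq_hardyNorm u hx.le, ← mazyaConst_indicator p r u v hx]
    refine (hardyNorm_le_mazyaConst hp hr hrp hv hV (hu.indicator measurableSet_Ioi) hh hfin).trans ?_
    rw [← mul_assoc]
    gcongr
    exact le_self_add
  le_opNorm x hx := by
    rw [← mazyaConst_indicator p r u v hx]
    have e : tailNorm r u x = hardyNorm r ((Ioi x).indicator u) :=
      funext fun h => tailNorm_eq_hardyNorm u hx.le h
    rw [e]
    refine (mazyaConst_le_opNorm hp hr hrp hv hV (hu.indicator measurableSet_Ioi)).trans ?_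
    gcongr
    exact le_add_self

/-! ### The best constant -/

theorem bestConst_le {p q r : ℝ} {u v w : ℝ → ℝ≥0∞} {D : ℝ≥0∞}
    (h : ∀ f, IsMPlus f → wnorm p v f ≠ ∞ → iterated q r u w f ≤ D * wnorm p v f) :
    bestConst p q r u v w ≤ D := by
  -- `D` itself may fail on functions of infinite norm, since `0 * ∞ = 0`
  refine ENNReal.le_of_forall_pos_le_add fun ε hε _ => sInf_le fun f hf => ?_
  by_cases hfin : wnorm p v f = ∞
  · rw [hfin, ENNReal.mul_top (by simp [hε.ne'])]
    exact le_top
  · exact (h f hf hfin).trans (by gcongr; exact le_self_add)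

theorem opNorm_le_bestConst (p q r : ℝ) (u v w : ℝ → ℝ≥0∞) :
    opNorm p v (iterated q r u w) ≤ bestConst p q r u v w := by
  refine le_sInf fun C hC => iSup₂_le fun f hf => (hC f hf.1).trans ?_
  calc C * wnorm p v f ≤ C * 1 := by gcongr; exact hf.2
    _ = C := mul_one C

theorem holds_iff_bestConst_lt_top (p q r : ℝ) (u v w : ℝ → ℝ≥0∞) :
    Holds p q r u v w ↔ bestConst p q r u v w < ∞ := by
  constructor
  · rintro ⟨C, _, hC⟩
    exact (sInf_le hC).trans_lt ENNReal.coe_lt_top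
  · intro h
    obtain ⟨C, hC, hCtop⟩ := sInf_lt_iff.1 h
    lift C to ℝ≥0 using hCtop.ne
    refine ⟨C + 1, by positivity, fun f hf => (hC f hf).trans ?_⟩
    gcongr
    simp

theorem tailNorm_antitone {r : ℝ} (hr : 0 < r) (u h : ℝ → ℝ≥0∞) :
    Antitone fun x => tailNorm r u x h := fun _ _ hxy =>
  ENNReal.rpow_le_rpow (lintegral_mono_set (Ioi_subset_Ioi hxy)) (by positivity)

theorem iterated_eq_lintegral_tailNorm {q r : ℝ} (hr : 0 < r) (u : ℝ → ℝ≥0∞) {w : ℝ → ℝ≥0∞}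
    (hw : IsMPlus w) (h : ℝ → ℝ≥0∞) :
    iterated q r u w h = (∫⁻ x, tailNorm r u x h ^ q ∂densityMeasure w) ^ (1 / q) := by
  rw [lintegral_densityMeasure hw ((tailNorm_antitone hr u h).measurable.pow_const _).aemeasurable,
    iterated]
  congr 2 with x
  rw [tailNorm, ← ENNReal.rpow_mul, one_div_mul_eq_div]

/-- For `t > x`, `∫_0^t h` is at least `∫_0^x h`, which can be taken out of the inner integral. -/
theorem hardyNorm_le_iterated {q r : ℝ} (hq : 0 < q) (hr : 0 < r) {u : ℝ → ℝ≥0∞} (hu : IsMPlus u)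
    (w h : ℝ → ℝ≥0∞) :
    hardyNorm q (fun x => copson u x ^ (q / r) * w x) h ≤ iterated q r u w h := by
  refine ENNReal.rpow_le_rpow (setLIntegral_mono' measurableSet_Ioi fun x hx => ?_) (by positivity)
  rw [← mul_assoc]
  gcongr
  calc hardy h x ^ q * copson u x ^ (q / r) = (hardy h x ^ r * copson u x) ^ (q / r) := by
        rw [ENNReal.mul_rpow_of_nonneg _ _ (by positivity), ← ENNReal.rpow_mul,
          mul_div_cancel₀ q hr.ne']
    _ ≤ _ := by
        gcongr ?_ ^ (q / r)
        have hum : AEMeasurable u (volume.restrict (Ioi x)) :=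
          hu.mono_measure (Measure.restrict_mono (Ioi_subset_Ioi (le_of_lt hx)) le_rfl)
        rw [copson, ← lintegral_const_mul'' _ hum]
        refine setLIntegral_mono' measurableSet_Ioi fun t ht => ?_
        gcongr
        exact hardy_mono h (le_of_lt ht)

theorem hardy_mul_tailNorm_le {q r : ℝ} (hq : 0 < q) (hr : 0 < r) (u : ℝ → ℝ≥0∞) {w : ℝ → ℝ≥0∞}
    (hw : IsMPlus w) (y : ℝ) (h : ℝ → ℝ≥0∞) :
    hardy w y ^ (1 / q) * tailNorm r u y h ≤ iterated q r u w h := by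
  rw [iterated_eq_lintegral_tailNorm hr u hw, ← densityMeasure_Iic]
  exact rpow_measure_mul_le_lintegral hq measurableSet_Iic _ _ fun x hx =>
    tailNorm_antitone hr u h hx

theorem hardy_pos {w : ℝ → ℝ≥0∞} (hw : IsWeight w) {x : ℝ} (hx : 0 < x) : hardy w x ≠ 0 := by
  intro h0
  have hsub : halfLine.restrict (Iic x) = volume.restrict (Ioc 0 x) := by
    rw [Measure.restrict_restrict measurableSet_Iic, inter_comm, Ioi_inter_Iic]
  have hm : AEMeasurable w (volume.restrict (Ioc 0 x)) := by
    rw [← hsub]; exact hw.1.mono_measure Measure.restrict_le_self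
  have hpos : ∀ᵐ t ∂volume.restrict (Ioc 0 x), 0 < w t := by
    rw [← hsub]; exact ae_restrict_of_ae hw.2
  have h1 := (lintegral_eq_zero_iff' hm).1 h0
  have h2 : ∀ᵐ t ∂volume.restrict (Ioc 0 x), False := by
    filter_upwards [h1, hpos] with t ht ht'
    exact ht'.ne' ht
  rw [Filter.eventually_false_iff_eq_bot, ae_eq_bot, Measure.restrict_eq_zero] at h2
  rw [Real.volume_Ioc, sub_zero, ENNReal.ofReal_eq_zero] at h2
  exact absurd hx (not_lt.2 h2)

theorem BlockBound.const_mul {p q : ℝ} (hp : 0 < p) (hq : 0 < q) {μ : Measure ℝ} {J : ℝ → ℝ≥0∞}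
    {D : ℝ≥0∞} (h : BlockBound p q μ J D) (c : ℝ≥0∞) :
    BlockBound p q μ (fun x => c * J x) (c * D) := by
  intro E n g hEm hE hdisj hn
  refine (h E n (fun k => c ^ p * g k) hEm hE hdisj fun k x hx => (hn k x hx).trans ?_).trans ?_
  · rw [ENNReal.mul_rpow_of_nonneg _ _ (by positivity), ← ENNReal.rpow_mul,
      mul_one_div_cancel hp.ne', ENNReal.rpow_one]
    exact le_of_eq (by ring)
  · rw [ENNReal.tsum_mul_left, ENNReal.mul_rpow_of_nonneg _ _ (by positivity), ← ENNReal.rpow_mul,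
      mul_div_cancel₀ q hp.ne', ENNReal.mul_rpow_of_nonneg _ _ hq.le]
    exact le_of_eq (by ring)

/-! ### Two-sided estimates -/

theorem bestConst_le_of_blockBound {p q r : ℝ} (hp : 1 < p) (hq : 0 < q) (hr : 0 < r)
    {u v w : ℝ → ℝ≥0∞} (hu : IsMPlus u) (hw : IsMPlus w) {c : ℝ≥0∞} (hc : c ≠ ∞) {T : ℝ → ℝ≥0∞}
    (hT : IsTailConst p r u v c T) (hTfin : ∀ x, 0 < x → T x ≠ ∞) {D F : ℝ≥0∞}
    (hD : BlockBound p q (densityMeasure w) T D)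
    (hF : ∀ h, IsMPlus h → wnorm p v h ≠ ∞ →
      hardyNorm q (fun x => copson u x ^ (q / r) * w x) h ≤ F * wnorm p v h) :
    bestConst p q r u v w ≤ iterConst q r * (F + c * D * 2 ^ (1 / p)) := by
  refine bestConst_le fun h hh hfin => ?_
  refine (iterated_le_of_blockBound hp hq hr hu hw hT.tailNorm_le
    (fun x hx => ENNReal.mul_ne_top hc (hTfin x hx)) (hD.const_mul (by linarith) hq c)
    hh hfin).trans ?_
  rw [mul_assoc (iterConst q r), add_mul]
  gcongr
  exact hF h hh hfin

theorem equivWith_of_le_mul {a b c₁ c₂ : ℝ≥0∞} {c : ℝ≥0} (h₁ : a ≤ c₁ * b) (h₂ : b ≤ c₂ * a)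
    (hc₁ : c₁ ≤ c) (hc₂ : c₂ ≤ c) : EquivWith c a b :=
  ⟨h₁.trans (by gcongr), h₂.trans (by gcongr)⟩

/-- For `p ≤ q`, the local Hardy inequalities enter through a supremum. -/
theorem exists_equivWith_of_le {p q r : ℝ} (hp : 1 < p) (hpq : p ≤ q) (hr : 0 < r) {c : ℝ≥0∞}
    (hc : c ≠ ∞) :
    ∃ C : ℝ≥0, 0 < C ∧ ∀ u v w : ℝ → ℝ≥0∞, IsWeight u → IsWeight v → IsWeight w →
      (∀ x : ℝ, 0 < x → dualPrimitive p v x < ∞) → ∀ T, IsTailConst p r u v c T →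
      EquivWith C (bestConst p q r u v w) (F₂ p q r u v w + ⨆ x ∈ Ioi (0 : ℝ),
        hardy w x ^ (1 / q) * T x) := by
  have hq : 0 < q := by linarith
  have hK₁ : iterConst q r * (4 + c * 2 ^ (1 / p)) ≠ ∞ :=
    ENNReal.mul_ne_top (iterConst_ne_top hq hr) (ENNReal.add_ne_top.2 ⟨by simp,
      ENNReal.mul_ne_top hc (ENNReal.rpow_ne_top_of_nonneg (by positivity) (by simp))⟩)
  have hK₂ : 1 + c ≠ ∞ := ENNReal.add_ne_top.2 ⟨by simp, hc⟩
  refine ⟨(iterConst q r * (4 + c * 2 ^ (1 / p))).toNNReal + (1 + c).toNNReal, ?_,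
    fun u v w hu hv hw hV T hT => ?_⟩
  · exact add_pos_of_nonneg_of_pos zero_le
      (ENNReal.toNNReal_pos (by simp) hK₂)
  set B := bestConst p q r u v w with hB
  set S := ⨆ x ∈ Ioi (0 : ℝ), hardy w x ^ (1 / q) * T x with hS
  have hF₂ : F₂ p q r u v w = muckenhouptConst p q v (fun x => copson u x ^ (q / r) * w x) := rfl
  have hφ : IsMPlus fun x => copson u x ^ (q / r) * w x :=
    ((measurable_copson u).pow_const _).aemeasurable.mul hw.1
  refine equivWith_of_le_mul (c₁ := iterConst q r * (4 + c * 2 ^ (1 / p))) (c₂ := 1 + c) ?_ ?_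
    (by rw [ENNReal.coe_add, ENNReal.coe_toNNReal hK₁]; exact le_self_add)
    (by rw [ENNReal.coe_add, ENNReal.coe_toNNReal hK₂]; exact le_add_self)
  · by_cases hStop : S = ∞
    · rw [hStop, add_top, ENNReal.mul_top]
      · exact le_top
      · exact mul_ne_zero (iterConst_ne_zero hq hr) (by simp)
    have hle : ∀ x, 0 < x → hardy w x ^ (1 / q) * T x ≤ S := fun x hx => le_iSup₂_of_le x hx le_rfl
    refine (bestConst_le_of_blockBound hp hq hr hu.1 hw.1 hc hT (fun x hx htop => ?_)
      (blockBound_of_le (isCumulative_hardy w) (by linarith) hpq hle)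
      (fun h hh hfin => hardyNorm_le_muckenhouptConst hp hpq hv hV hφ hh hfin)).trans ?_
    · have := hle x hx
      rw [htop, ENNReal.mul_top] at this
      · exact hStop (top_le_iff.1 this)
      · rw [ne_eq, ENNReal.rpow_eq_zero_iff_of_pos (by positivity)]
        exact hardy_pos hw hx
    · rw [mul_assoc (iterConst q r), ← hF₂]
      refine mul_le_mul' le_rfl ?_
      rw [add_mul, mul_add, mul_add, mul_right_comm c S]
      exact add_le_add le_self_add le_add_self
  · rw [add_mul, one_mul]
    refine add_le_add ?_ (iSup₂_le fun x hx => ?_)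
    · rw [hF₂]
      exact (muckenhouptConst_le_opNorm hp hq hv hV hφ).trans
        ((opNorm_mono (hardyNorm_le_iterated hq hr hu.1 w)).trans (opNorm_le_bestConst _ _ _ _ _ _))
    · calc hardy w x ^ (1 / q) * T x ≤ hardy w x ^ (1 / q) * (c * opNorm p v (tailNorm r u x)) := by
            gcongr
            exact hT.le_opNorm x hx
        _ = c * (hardy w x ^ (1 / q) * opNorm p v (tailNorm r u x)) := by ring
        _ ≤ c * B := by
            gcongr
            refine le_trans ?_ (opNorm_le_bestConst p q r u v w)
            simp only [opNorm, ENNReal.mul_iSup]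
            exact iSup₂_mono fun h _ => hardy_mul_tailNorm_le hq hr u hw.1 x h

/-- If a local constant is infinite, then so is the integral functional, because `w` is positive. -/
theorem lintegral_hardy_rpow_eq_top {a b : ℝ} (ha : 0 < a) (hb : 0 < b) {w : ℝ → ℝ≥0∞}
    (hw : IsWeight w) {T : ℝ → ℝ≥0∞} (hT : Antitone T) {x : ℝ} (hx : 0 < x) (hTx : T x = ∞) :
    ∫⁻ t in Ioi 0, T t ^ a * hardy w t ^ b * w t = ∞ := by
  by_contra hne
  have hm : AEMeasurable (fun t => T t ^ a * hardy w t ^ b * w t) halfLine :=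
    ((hT.measurable.pow_const _).mul ((measurable_hardy w).pow_const _)).aemeasurable.mul hw.1
  have hsub : halfLine.restrict (Iic x) = volume.restrict (Ioc 0 x) := by
    rw [Measure.restrict_restrict measurableSet_Iic, inter_comm, Ioi_inter_Iic]
  have h2 : ∀ᵐ t ∂volume.restrict (Ioc 0 x), False := by
    rw [← hsub]
    filter_upwards [ae_restrict_of_ae (ae_lt_top' hm hne), ae_restrict_of_ae hw.2,
      ae_restrict_mem measurableSet_Iic, ae_restrict_of_ae (ae_restrict_mem measurableSet_Ioi)]
      with t ht hwt htx ht0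
    have hTt : T t = ∞ := top_le_iff.1 (hTx ▸ hT htx)
    rw [hTt, ENNReal.top_rpow_of_pos ha, ENNReal.top_mul, ENNReal.top_mul hwt.ne'] at ht
    · exact lt_irrefl _ ht
    · rw [ne_eq, ENNReal.rpow_eq_zero_iff_of_pos hb]
      exact hardy_pos hw ht0
  rw [Filter.eventually_false_iff_eq_bot, ae_eq_bot, Measure.restrict_eq_zero] at h2
  rw [Real.volume_Ioc, sub_zero, ENNReal.ofReal_eq_zero] at h2
  exact absurd hx (not_lt.2 h2)

/-- For `q < p`, the local Hardy inequalities enter through an integral. -/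
theorem exists_equivWith_of_lt {p q r : ℝ} (hp : 1 < p) (hq : 0 < q) (hqp : q < p) (hr : 0 < r)
    {c : ℝ≥0∞} (hc : c ≠ ∞) :
    ∃ C : ℝ≥0, 0 < C ∧ ∀ u v w : ℝ → ℝ≥0∞, IsWeight u → IsWeight v → IsWeight w →
      (∀ x : ℝ, 0 < x → dualPrimitive p v x < ∞) → ∀ T, IsTailConst p r u v c T →
      EquivWith C (bestConst p q r u v w) (F₄ p q r u v w + (∫⁻ x in Ioi 0,
        T x ^ (p * q / (p - q)) * hardy w x ^ (q / (p - q)) * w x) ^ ((p - q) / (p * q))) := by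
  have hp0 : 0 < p := by linarith
  have hd : 0 < p - q := by linarith
  have h2 : (2 : ℝ≥0∞) ^ (1 / q) ≠ ∞ := ENNReal.rpow_ne_top_of_nonneg (by positivity) (by simp)
  have h24 : ((2 : ℝ≥0∞) ^ q * 4) ^ (1 / q) ≠ ∞ := ENNReal.rpow_ne_top_of_nonneg (by positivity)
    (ENNReal.mul_ne_top (ENNReal.rpow_ne_top_of_nonneg hq.le (by simp)) (by simp))
  set K₁ := iterConst q r * (4 * 2 ^ (1 / q) + c * 2 ^ (1 / q) * 2 ^ (1 / p)) with hK₁def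
  set K₂ := ((2 : ℝ≥0∞) ^ q * 4) ^ (1 / q) + c * (2 ^ q * 4) ^ (1 / q) + 1 with hK₂def
  have hK₁ : K₁ ≠ ∞ :=
    ENNReal.mul_ne_top (iterConst_ne_top hq hr) (ENNReal.add_ne_top.2
      ⟨ENNReal.mul_ne_top (by simp) h2, ENNReal.mul_ne_top (ENNReal.mul_ne_top hc h2)
        (ENNReal.rpow_ne_top_of_nonneg (by positivity) (by simp))⟩)
  have hK₂ : K₂ ≠ ∞ := ENNReal.add_ne_top.2
    ⟨ENNReal.add_ne_top.2 ⟨h24, ENNReal.mul_ne_top hc h24⟩, by simp⟩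
  refine ⟨K₁.toNNReal + K₂.toNNReal, ?_, fun u v w hu hv hw hV T hT => ?_⟩
  · exact add_pos_of_nonneg_of_pos zero_le (ENNReal.toNNReal_pos (by simp [hK₂def]) hK₂)
  set B := bestConst p q r u v w with hB
  set S := (∫⁻ x in Ioi 0, T x ^ (p * q / (p - q)) * hardy w x ^ (q / (p - q)) * w x) ^
    ((p - q) / (p * q)) with hS
  have hφ : IsMPlus fun x => copson u x ^ (q / r) * w x :=
    ((measurable_copson u).pow_const _).aemeasurable.mul hw.1
  have hF₄ : F₄ p q r u v w = mazyaConst p q v (fun x => copson u x ^ (q / r) * w x) := by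
    rw [F₄, mazyaConst]
    congr 1
    refine lintegral_congr fun x => ?_
    change (copson (fun t => copson u t ^ (q / r) * w t) x) ^ (q / (p - q)) * copson u x ^ (q / r) *
      dualPrimitive p v x ^ ((p - 1) * q / (p - q)) * w x = _
    ring
  have hdens : ∀ J : ℝ → ℝ≥0∞, Antitone J →
      ∫⁻ x, J x ^ (p * q / (p - q)) * hardy w x ^ (q / (p - q)) ∂densityMeasure w =
      ∫⁻ x in Ioi 0, J x ^ (p * q / (p - q)) * hardy w x ^ (q / (p - q)) * w x := fun J hJ =>
    lintegral_densityMeasure hw.1 (Measurable.mul (hJ.measurable.pow_const _)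
      ((measurable_hardy w).pow_const _)).aemeasurable
  refine equivWith_of_le_mul (c₁ := K₁) (c₂ := K₂) ?_ ?_
    (by rw [ENNReal.coe_add, ENNReal.coe_toNNReal hK₁]; exact le_self_add)
    (by rw [ENNReal.coe_add, ENNReal.coe_toNNReal hK₂]; exact le_add_self)
  · by_cases hStop : S = ∞
    · rw [hStop, add_top, ENNReal.mul_top]
      · exact le_top
      · refine mul_ne_zero (iterConst_ne_zero hq hr) ?_
        simp [hq.not_gt, ENNReal.rpow_eq_zero_iff]
    have hblock := blockBound_of_lt (isCumulative_hardy w) hq hqp hT.antitone.measurable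
    rw [hdens T hT.antitone, ← hS] at hblock
    refine (bestConst_le_of_blockBound hp hq hr hu.1 hw.1 hc hT (fun x hx htop => hStop ?_)
      hblock (fun h hh hfin => hardyNorm_le_mazyaConst hp hq hqp hv hV hφ hh hfin)).trans ?_
    · rw [hS, lintegral_hardy_rpow_eq_top (by positivity) (by positivity) hw hT.antitone hx htop,
        ENNReal.top_rpow_of_pos (by positivity)]
    · rw [← hF₄, hK₁def, mul_assoc (iterConst q r)]
      refine mul_le_mul' le_rfl ?_
      rw [add_mul, mul_add, mul_add]
      refine add_le_add ?_ ?_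
      · rw [← mul_assoc]; exact le_self_add
      · refine le_trans (le_of_eq ?_) le_add_self
        ring
  · have hlow₁ : F₄ p q r u v w ≤ (2 ^ q * 4) ^ (1 / q) * B := by
      rw [hF₄]
      refine (mazyaConst_le_opNorm hp hq hqp hv hV hφ).trans ?_
      gcongr
      exact (opNorm_mono (hardyNorm_le_iterated hq hr hu.1 w)).trans
        (opNorm_le_bestConst _ _ _ _ _ _)
    have hlow₂ : S ≤ c * ((2 ^ q * 4) ^ (1 / q) * B) := by
      set J : ℝ → ℝ≥0∞ := fun x => opNorm p v (tailNorm r u x) with hJ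
      have hJanti : Antitone J := fun x y hxy => opNorm_mono fun h => tailNorm_antitone hr u h hxy
      have key := lintegral_le_opNorm hq hqp (isCumulative_hardy w) hv.1 (fun x h => tailNorm r u x h)
        (fun x f g hfg => by
          refine ENNReal.rpow_le_rpow (lintegral_mono fun t => ?_) (by positivity)
          gcongr
          exact hardy_mono_fun hfg t)
        (fun x a h ha => by
          simp only [tailNorm, hardy_const_mul ha, ENNReal.mul_rpow_of_nonneg _ _ hr.le, mul_assoc]
          rw [lintegral_const_mul' _ _ (ENNReal.rpow_ne_top_of_nonneg hr.le ha),
            ENNReal.mul_rpow_of_nonneg _ _ (by positivity), ← ENNReal.rpow_mul,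
            mul_one_div_cancel hr.ne', ENNReal.rpow_one])
        (fun x y hxy h => tailNorm_antitone hr u h ((hardy_mono w).reflect_lt hxy).le)
        (fun y h => by
          rw [← iterated_eq_lintegral_tailNorm hr u hw.1]
          exact hardy_mul_tailNorm_le hq hr u hw.1 y h)
        J (fun x => le_rfl)
      simp only [← iterated_eq_lintegral_tailNorm hr u hw.1] at key
      rw [hdens J hJanti] at key
      calc S ≤ (∫⁻ x in Ioi 0, c ^ (p * q / (p - q)) * (J x ^ (p * q / (p - q)) *
            hardy w x ^ (q / (p - q)) * w x)) ^ ((p - q) / (p * q)) := by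
            rw [hS]
            gcongr ?_ ^ ((p - q) / (p * q))
            refine setLIntegral_mono' measurableSet_Ioi fun x hx => ?_
            rw [← mul_assoc, ← mul_assoc, ← ENNReal.mul_rpow_of_nonneg _ _ (by positivity)]
            gcongr
            exact hT.le_opNorm x hx
        _ = c * (∫⁻ x in Ioi 0, J x ^ (p * q / (p - q)) *
            hardy w x ^ (q / (p - q)) * w x) ^ ((p - q) / (p * q)) := by
            rw [lintegral_const_mul' _ _ (ENNReal.rpow_ne_top_of_nonneg (by positivity) hc),
              ENNReal.mul_rpow_of_nonneg _ _ (by positivity), ← ENNReal.rpow_mul,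
              show p * q / (p - q) * ((p - q) / (p * q)) = 1 by field_simp, ENNReal.rpow_one]
        _ ≤ _ := by
            gcongr
            exact key.trans (by gcongr; exact opNorm_le_bestConst _ _ _ _ _ _)
    calc _ ≤ _ := add_le_add hlow₁ hlow₂
      _ ≤ _ := by
          rw [← mul_assoc, ← add_mul, hK₂def]
          exact mul_le_mul' le_self_add le_rfl

/-! ### The four cases -/

/-- Since `∫_0^x w` increases, the inner supremum over `t ≥ x` may be taken at `t = x`. -/
theorem F₁_eq (p q r : ℝ) (hq : 0 < q) (u v w : ℝ → ℝ≥0∞) :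
    F₁ p q r u v w = ⨆ x ∈ Ioi (0 : ℝ), hardy w x ^ (1 / q) *
      ⨆ t ∈ Ici x, copson u t ^ (1 / r) * dualPrimitive p v t ^ (1 / p.conjExponent) := by
  refine le_antisymm (iSup₂_mono fun x _ => ?_) (iSup₂_le fun x hx => ?_)
  · rw [mul_assoc]
    gcongr
    exact le_iSup₂_of_le x (mem_Ici.2 le_rfl) le_rfl
  · simp only [ENNReal.mul_iSup]
    refine iSup₂_le fun t ht => le_iSup₂_of_le t (mem_Ioi.2 (lt_of_lt_of_le hx ht)) ?_
    rw [mul_assoc]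
    gcongr
    exact hardy_mono w ht

theorem F₆_eq {p q r : ℝ} (hq : 0 < q) (hqp : q < p) (hr : 0 < r) (u v w : ℝ → ℝ≥0∞) :
    F₆ p q r u v w = (∫⁻ x in Ioi 0, (innerInt p r u v x ^ ((p - r) / (p * r))) ^ (p * q / (p - q)) *
      hardy w x ^ (q / (p - q)) * w x) ^ ((p - q) / (p * q)) := by
  have hp : p ≠ 0 := by linarith
  have hd : p - q ≠ 0 := by linarith
  rw [F₆]
  congr 1
  refine lintegral_congr fun x => ?_
  rw [← ENNReal.rpow_mul, show (p - r) / (p * r) * (p * q / (p - q)) =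
    q * (p - r) / (r * (p - q)) by field_simp]
  ring

theorem holds_iff_of_equivWith {p q r : ℝ} {u v w : ℝ → ℝ≥0∞} {c : ℝ≥0} {a b : ℝ≥0∞}
    (h : EquivWith c (bestConst p q r u v w) (a + b)) :
    Holds p q r u v w ↔ a < ∞ ∧ b < ∞ := by
  rw [holds_iff_bestConst_lt_top, ← ENNReal.add_lt_top]
  exact ⟨fun hB => h.2.trans_lt (ENNReal.mul_lt_top ENNReal.coe_lt_top hB),
    fun hF => h.1.trans_lt (ENNReal.mul_lt_top ENNReal.coe_lt_top hF)⟩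

theorem tailConst_factor_ne_top {r : ℝ} (hr : 0 < r) :
    (4 * 2 ^ (1 / r) + (2 ^ r * 4) ^ (1 / r) : ℝ≥0∞) ≠ ∞ :=
  ENNReal.add_ne_top.2 ⟨ENNReal.mul_ne_top (by simp)
    (ENNReal.rpow_ne_top_of_nonneg (by positivity) (by simp)),
    ENNReal.rpow_ne_top_of_nonneg (by positivity)
      (ENNReal.mul_ne_top (ENNReal.rpow_ne_top_of_nonneg hr.le (by simp)) (by simp))⟩

end IteratedHardy

theorem mainTheorem9 (p q r : ℝ) (hp : 1 < p) (hq : 0 < q) (hr : 0 < r) :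
    ∃ c : ℝ≥0, 0 < c ∧
      ∀ u v w : ℝ → ℝ≥0∞,
        IteratedHardy.IsWeight u → IteratedHardy.IsWeight v → IteratedHardy.IsWeight w →
        (∀ x : ℝ, 0 < x → IteratedHardy.dualPrimitive p v x < ∞) →
        (p ≤ min q r →
          (IteratedHardy.Holds p q r u v w ↔
            IteratedHardy.F₁ p q r u v w < ∞ ∧ IteratedHardy.F₂ p q r u v w < ∞) ∧
          IteratedHardy.EquivWith c (IteratedHardy.bestConst p q r u v w)
            (IteratedHardy.F₁ p q r u v w + IteratedHardy.F₂ p q r u v w)) ∧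
        (q < p ∧ p ≤ r →
          (IteratedHardy.Holds p q r u v w ↔
            IteratedHardy.F₃ p q r u v w < ∞ ∧ IteratedHardy.F₄ p q r u v w < ∞) ∧
          IteratedHardy.EquivWith c (IteratedHardy.bestConst p q r u v w)
            (IteratedHardy.F₃ p q r u v w + IteratedHardy.F₄ p q r u v w)) ∧
        (r < p ∧ p ≤ q →
          (IteratedHardy.Holds p q r u v w ↔
            IteratedHardy.F₂ p q r u v w < ∞ ∧ IteratedHardy.F₅ p q r u v w < ∞) ∧
          IteratedHardy.EquivWith c (IteratedHardy.bestConst p q r u v w)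
            (IteratedHardy.F₂ p q r u v w + IteratedHardy.F₅ p q r u v w)) ∧
        (max q r < p →
          (IteratedHardy.Holds p q r u v w ↔
            IteratedHardy.F₄ p q r u v w < ∞ ∧ IteratedHardy.F₆ p q r u v w < ∞) ∧
          IteratedHardy.EquivWith c (IteratedHardy.bestConst p q r u v w)
            (IteratedHardy.F₄ p q r u v w + IteratedHardy.F₆ p q r u v w)) := by
  open IteratedHardy in
  rcases le_or_gt p q with hpq | hqp <;> rcases le_or_gt p r with hpr | hrp
  · obtain ⟨C, hC, H⟩ := exists_equivWith_of_le hp hpq hr (c := 4) (by simp)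
    refine ⟨C, hC, fun u v w hu hv hw hV => ⟨fun _ => ?_, fun h => absurd h.1 (not_lt.2 hpq),
      fun h => absurd h.1 (not_lt.2 hpr), fun h => absurd (max_lt_iff.1 h).1 (not_lt.2 hpq)⟩⟩
    have key := H u v w hu hv hw hV _ (isTailConst_of_le hp hpr hu.1 hv hV)
    rw [← F₁_eq p q r hq, add_comm] at key
    exact ⟨holds_iff_of_equivWith key, key⟩
  · obtain ⟨C, hC, H⟩ := exists_equivWith_of_le hp hpq hr (tailConst_factor_ne_top hr)
    refine ⟨C, hC, fun u v w hu hv hw hV => ⟨fun h => absurd hrp (not_lt.2 (le_min_iff.1 h).2),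
      fun h => absurd h.1 (not_lt.2 hpq), fun _ => ?_,
      fun h => absurd (max_lt_iff.1 h).1 (not_lt.2 hpq)⟩⟩
    have key : EquivWith C _ (F₂ p q r u v w + F₅ p q r u v w) :=
      H u v w hu hv hw hV _ (isTailConst_of_lt hp hr hrp hu.1 hv hV)
    exact ⟨holds_iff_of_equivWith key, key⟩
  · obtain ⟨C, hC, H⟩ := exists_equivWith_of_lt hp hq hqp hr (c := 4) (by simp)
    refine ⟨C, hC, fun u v w hu hv hw hV => ⟨fun h => absurd hqp (not_lt.2 (le_min_iff.1 h).1),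
      fun _ => ?_, fun h => absurd h.1 (not_lt.2 hpr),
      fun h => absurd (max_lt_iff.1 h).2 (not_lt.2 hpr)⟩⟩
    have key : EquivWith C _ (F₄ p q r u v w + F₃ p q r u v w) :=
      H u v w hu hv hw hV _ (isTailConst_of_le hp hpr hu.1 hv hV)
    rw [add_comm] at key
    exact ⟨holds_iff_of_equivWith key, key⟩
  · obtain ⟨C, hC, H⟩ := exists_equivWith_of_lt hp hq hqp hr (tailConst_factor_ne_top hr)
    refine ⟨C, hC, fun u v w hu hv hw hV => ⟨fun h => absurd hqp (not_lt.2 (le_min_iff.1 h).1),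
      fun h => absurd hrp (not_lt.2 h.2), fun h => absurd hqp (not_lt.2 h.2), fun _ => ?_⟩⟩
    have key := H u v w hu hv hw hV _ (isTailConst_of_lt hp hr hrp hu.1 hv hV)
    rw [← F₆_eq hq hqp hr] at key
    exact ⟨holds_iff_of_equivWith key, key⟩
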